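/- **Conventions.** Let $\mathcal S$ be the space of complex-valued Schwartz functions on $\mathbb R$ and $\mathcal S'$ its dual, with $\langle f,\psi\rangle=\int f\psi$; $\widehat f(\omega)=\int f(x)e^{-i\omega x}dx$, $\mathcal F^{-1}\{g\}(x)=\frac1{2\pi}\int g(\omega)e^{i\omega x}d\omega$, extended to $\mathcal S'$ by duality. All complex powers are principal. For $a,b\in\mathbb C\setminus\{0\}$ and $\gamma\in\mathbb C$ put $h(\omega)=h^\gamma_{a,b}(\omega)=a|\omega|^\gamma$ for $\omega>0$, $b|\omega|^\gamma$ for $\omega<0$, and $h(0)=0$. For $\varphi\in\mathcal S$ and $k\in\mathbb N$ define $$(\mathrm D^\gamma_{a,b}\varphi)(x)=\tfrac1{2\pi}\int\widehat\varphi(\omega)h(\omega)e^{i\omega x}d\omega\qquad(\operatorname{Re}\gamma>-1),$$ $$(\mathrm I^{\gamma;k}_{a,b}\varphi)(x)=\tfrac1{2\pi}\int\widehat\varphi(\omega)\,\frac{e^{i\omega x}-\sum_{j=0}^{k-1}\frac{(ix)^j}{j!}\omega^j}{h(\omega)}d\omega,\qquad \mathrm I^{(\gamma;k)*}_{a,b}\varphi=\mathcal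 F^{-1}\Big\{\frac{\widehat\varphi(\cdot)-\sum_{j=0}^{k-1}\frac{\widehat\varphi^{(j)}(0)}{j!}(\cdot)^j}{h(-\,\cdot)}\Big\}\in\mathcal S'$$ (the last two for $\operatorname{Re}\gamma>0$). The *response* $\mathrm L\{\delta(\cdot-\tau)\}\in\mathcal S'$ of a linear operator $\mathrm L:\mathcal S\to\mathcal S'$ is the weak-* limit of $\mathrm L\varphi_n$ along all sequences $\varphi_n\in\mathcal S$ with $\varphi_n\ge0$, $\int\varphi_n=1$ and supports shrinking to $\{\tau\}$. Let $\binom zj=\frac{z(z-1)\cdots(z-j+1)}{j!}$, $\binom z0=1$, and $$K_{\mathrm D}(x,\tau)=\tfrac{\Gamma(\gamma+1)}{2\pi}\Big(\tfrac{a}{(i\tau-ix)^{\gamma+1}}+\tfrac{b}{(ix-i\tau)^{\gamma+1}}\Big),$$ $$K_{\mathrm I}(x,\tau)=\tfrac{\Gamma(1-\gamma)}{2\pi}\Big(\tfrac{(i\tau-ix)^{\gamma-1}}a+\tfrac{(ix-i\tau)^{\gamma-1}}b\Big)-\tfrac{\Gamma(1-\gamma)}{2\pi}\Big(\tfrac{(i\tau)^{\gamma-1}}a+\tfrac{(-i\tau)^{\gamma-1}}b\Big)\sum_{j=0}^{k-1}\tbinom{j-\gamma}{j}\big(\tfrac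 x\tau\big)^j,$$ $$K_{\mathrm I^*}(x,\tau)=\tfrac{\Gamma(1-\gamma)}{2\pi}\Big(\tfrac{(ix-i\tau)^{\gamma-1}}a+\tfrac{(i\tau-ix)^{\gamma-1}}b\Big)-\tfrac{\Gamma(1-\gamma)}{2\pi}\Big(\tfrac{(ix)^{\gamma-1}}a+\tfrac{(-ix)^{\gamma-1}}b\Big)\sum_{j=0}^{k-1}\tbinom{j-\gamma}{j}\big(\tfrac \tau x\big)^j.$$ For $\varepsilon>0$ let $K^\varepsilon_{\mathrm D},K^\varepsilon_{\mathrm I},K^\varepsilon_{\mathrm I^*}$ be obtained by expanding the products and replacing $\pm i(x-\tau)$ by $\varepsilon\pm i(x-\tau)$ and, in the correction sums, $(\pm i\tau)^{\gamma-1}(\frac x\tau)^j$ by $(\varepsilon\pm i\tau)^{\gamma-1}\big(\frac{\pm ix}{\varepsilon\pm i\tau}\big)^j$ (for $\mathrm I$) and $(\pm ix)^{\gamma-1}(\frac \tau x)^j$ by $(\varepsilon\pm ix)^{\gamma-1}\big(\frac{\pm i\tau}{\varepsilon\pm ix}\big)^j$ (for $\mathrm I^*$). **Theorem.** Let $a,b\in\mathbb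 C\setminus\{0\}$ and $\gamma\in\mathbb C\setminus\mathbb Z$. 1. Let $\operatorname{Re}\gamma>-1$. For every $\tau\in\mathbb R$ the response $\mathrm D^\gamma_{a,b}\{\delta(\cdot-\tau)\}$ exists, equals $\mathcal F^{-1}\{e^{-i\omega\tau}h(\omega)\}$, is the function $x\mapsto K_{\mathrm D}(x,\tau)$ on $\mathbb R\setminus\{\tau\}$, and on all of $\mathbb R$ is the limit of $K^\varepsilon_{\mathrm D}(\cdot,\tau)$ in $\mathcal S'$ as $\varepsilon\downarrow0$. For all $\varphi\in\mathcal S$: $(\mathrm D^\gamma_{a,b}\varphi)(x)=\int K_{\mathrm D}(x,\tau)\varphi(\tau)d\tau$ (absolutely convergent) if $x\notin\operatorname{supp}\varphi$, and $(\mathrm D^\gamma_{a,b}\varphi)(x)=\lim_{\varepsilon\downarrow0}\int K^\varepsilon_{\mathrm D}(x,\tau)\varphi(\tau)d\tau$ for every $x\in\mathbb R$. 2. Let $\operatorname{Re}\gamma>0$ and $k\ge\max(1,\lfloor\operatorname{Re}\gamma\rfloor)$. For every $\tau\ne0$ the response $\mathrm I^{\gamma;k}_{a,b}\{\delta(\cdot-\tau)\}$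 exists and is, on all of $\mathbb R$, the function $x\mapsto K_{\mathrm I}(x,\tau)$. If $\varphi\in\mathcal S$ and $0\notin\operatorname{supp}\varphi$, then $(\mathrm I^{\gamma;k}_{a,b}\varphi)(x)=\int K_{\mathrm I}(x,\tau)\varphi(\tau)d\tau$ (absolutely convergent) for every $x$; for every $\varphi\in\mathcal S$ and every $x$, $(\mathrm I^{\gamma;k}_{a,b}\varphi)(x)=\lim_{\varepsilon\downarrow0}\int K^\varepsilon_{\mathrm I}(x,\tau)\varphi(\tau)d\tau$. 3. Let $\operatorname{Re}\gamma>0$ and $k\ge\max(1,\lfloor\operatorname{Re}\gamma\rfloor)$. For every $\tau\in\mathbb R$ the response $\mathrm I^{(\gamma;k)*}_{a,b}\{\delta(\cdot-\tau)\}$ exists, equals $\mathcal F^{-1}\big\{\big(e^{-i\omega\tau}-\sum_{j<k}\frac{(-i\omega\tau)^j}{j!}\big)/h(-\omega)\big\}$, is the function $x\mapsto K_{\mathrm I^*}(x,\tau)$ on $\mathbb R\setminus\{0\}$, and on all of $\mathbb R$ is the limit of $K^\varepsilon_{\mathrm I^*}(\cdot,\tau)$ in $\mathcal S'$ as $\varepsilon\downarrow0$.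 For every $\varphi\in\mathcal S$, $\mathrm I^{(\gamma;k)*}_{a,b}\varphi$ is a tempered distribution; on $\mathbb R\setminus\{0\}$ it is the function $x\mapsto\int K_{\mathrm I^*}(x,\tau)\varphi(\tau)d\tau$ (absolutely convergent), and it is the limit in $\mathcal S'$ of $x\mapsto\int K^\varepsilon_{\mathrm I^*}(x,\tau)\varphi(\tau)d\tau$ as $\varepsilon\downarrow0$. -/

import Mathlib

open Filter Topology MeasureTheory
open scoped SchwartzMap

namespace ComplexFrac

noncomputable section

/-! ### Fourier transforms (angular frequency) -/

/-- `φ̂(ω) = ∫ φ(x) e^{-iωx} dx`. -/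
def angFourier (φ : ℝ → ℂ) (ω : ℝ) : ℂ :=
  ∫ x : ℝ, φ x * Complex.exp (-(Complex.I * ω * x))

/-- `(F⁻¹ ψ)(x) = (1/2π) ∫ ψ(ω) e^{iωx} dω`. -/
def invAngFourier (ψ : ℝ → ℂ) (x : ℝ) : ℂ :=
  1 / (2 * Real.pi) * ∫ ω : ℝ, ψ ω * Complex.exp (Complex.I * ω * x)

/-- The tempered distribution `U` is the inverse Fourier transform of the (locally integrable)
function `g`, in the distributional sense `⟨F⁻¹ g, ψ⟩ = ⟨g, F⁻¹ ψ⟩`. -/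
def IsInvFourier (g : ℝ → ℂ) (U : 𝓢'(ℝ, ℂ)) : Prop :=
  ∀ ψ : 𝓢(ℝ, ℂ), Integrable (fun ω => g ω * invAngFourier ψ ω) ∧
    U ψ = ∫ ω : ℝ, g ω * invAngFourier ψ ω

/-- The restriction of the tempered distribution `U` to the open set `s` is the function `f`. -/
def AgreesOn (U : 𝓢'(ℝ, ℂ)) (f : ℝ → ℂ) (s : Set ℝ) : Prop :=
  ∀ ψ : 𝓢(ℝ, ℂ), tsupport ψ ⊆ s →
    Integrable (fun x => f x * ψ x) ∧ U ψ = ∫ x : ℝ, f x * ψ x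

/-! ### The operators -/

/-- The homogeneous multiplier `h(ω) = a ω₊^γ + b ω₋^γ` for `ω ≠ 0`, `h(0) = 0`, where
`ω₊ ^ γ` is `|ω| ^ γ` on `ω > 0` and `ω₋ ^ γ` is `|ω| ^ γ` on `ω < 0`. -/
def homMult (a b γ : ℂ) (ω : ℝ) : ℂ :=
  if 0 < ω then a * (ω : ℂ) ^ γ else if ω < 0 then b * ((-ω : ℝ) : ℂ) ^ γ else 0

/-- The derivative `(D φ)(x) = (1/2π) ∫ φ̂(ω) h(ω) e^{iωx} dω`. -/
def fracD (a b γ : ℂ) (φ : 𝓢(ℝ, ℂ)) (x : ℝ) : ℂ :=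
  1 / (2 * Real.pi) *
    ∫ ω : ℝ, angFourier φ ω * homMult a b γ ω * Complex.exp (Complex.I * ω * x)

/-- The integrator
`(I φ)(x) = (1/2π) ∫ φ̂(ω) (e^{iωx} - ∑_{j<k} (ix)^j ω^j / j!) / h(ω) dω`. -/
def fracI (a b γ : ℂ) (k : ℕ) (φ : 𝓢(ℝ, ℂ)) (x : ℝ) : ℂ :=
  1 / (2 * Real.pi) *
    ∫ ω : ℝ, angFourier φ ω *
      ((Complex.exp (Complex.I * ω * x) -
        ∑ j ∈ Finset.range k, (Complex.I * x) ^ j / (j.factorial : ℂ) * (ω : ℂ) ^ j) /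
          homMult a b γ ω)

/-- `(g(ω) - ∑_{j<k} g⁽ʲ⁾(0) ω^j / j!) / h(-ω)`: for an input with Fourier transform `g`, the
Fourier transform of its image under the adjoint integrator. -/
def adjSymbol (a b γ : ℂ) (k : ℕ) (g : ℝ → ℂ) (ω : ℝ) : ℂ :=
  (g ω - ∑ j ∈ Finset.range k, iteratedDeriv j g 0 / (j.factorial : ℂ) * (ω : ℂ) ^ j) /
    homMult a b γ (-ω)

/-- The pairing `⟨f, ψ⟩ = ∫ f ψ`. -/
def pairing (f : ℝ → ℂ) (ψ : 𝓢(ℝ, ℂ)) : ℂ := ∫ x : ℝ, f x * ψ x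

/-- The adjoint integrator `I* φ`, a tempered distribution: `fracIAdj a b γ k φ ψ` is
`⟨I* φ, ψ⟩`, where `I* φ` is the distributional inverse Fourier transform of
`adjSymbol a b γ k φ̂`. -/
def fracIAdj (a b γ : ℂ) (k : ℕ) (φ ψ : 𝓢(ℝ, ℂ)) : ℂ :=
  ∫ ω : ℝ, adjSymbol a b γ k (angFourier φ) ω * invAngFourier ψ ω

/-! ### Response to a shifted Dirac impulse -/

/-- A sequence of nonnegative test functions of mass one with supports shrinking to `τ`, i.e. a
smooth approximation of `δ(· - τ)`. -/
def IsDeltaSequence (τ : ℝ) (φ : ℕ → 𝓢(ℝ, ℂ)) : Prop :=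
  (∀ n x, ∃ r : ℝ, 0 ≤ r ∧ φ n x = (r : ℂ)) ∧
  (∀ n, ∫ x : ℝ, φ n x = 1) ∧
  ∀ r : ℝ, 0 < r → ∀ᶠ n in atTop, tsupport (φ n) ⊆ Metric.ball τ r

/-- `U` is the response to `δ(· - τ)` of the linear operator `L : 𝓢 → 𝓢'`, given through
`L φ ψ = ⟨L φ, ψ⟩`: `L φₙ → U` in the weak-* sense along every smooth approximation `φₙ` of
`δ(· - τ)`. -/
def IsImpulseResponse (L : 𝓢(ℝ, ℂ) → 𝓢(ℝ, ℂ) → ℂ) (τ : ℝ) (U : 𝓢'(ℝ, ℂ)) : Prop :=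
  ∀ φ : ℕ → 𝓢(ℝ, ℂ), IsDeltaSequence τ φ →
    ∀ ψ : 𝓢(ℝ, ℂ), Tendsto (fun n => L (φ n) ψ) atTop (𝓝 (U ψ))

/-- The Fourier transform `e^{-iωτ}` of `δ(· - τ)`. -/
def fourierDirac (τ ω : ℝ) : ℂ := Complex.exp (-(Complex.I * ω * τ))

/-! ### The closed forms -/

/-- The generalized binomial coefficient `z (z-1) ⋯ (z-j+1) / j!`. -/
def genBinom (z : ℂ) (j : ℕ) : ℂ :=
  (∏ i ∈ Finset.range j, (z - i)) / (j.factorial : ℂ)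

def kernelD (a b γ : ℂ) (x τ : ℝ) : ℂ :=
  Complex.Gamma (γ + 1) / (2 * Real.pi) *
    (a / (Complex.I * τ - Complex.I * x) ^ (γ + 1) +
      b / (Complex.I * x - Complex.I * τ) ^ (γ + 1))

def kernelI (a b γ : ℂ) (k : ℕ) (x τ : ℝ) : ℂ :=
  Complex.Gamma (1 - γ) / (2 * Real.pi) *
    ((Complex.I * τ - Complex.I * x) ^ (γ - 1) / a +
      (Complex.I * x - Complex.I * τ) ^ (γ - 1) / b) -
  Complex.Gamma (1 - γ) / (2 * Real.pi) *
    ((Complex.I * τ) ^ (γ - 1) / a + (-(Complex.I * τ)) ^ (γ - 1) / b) *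
      ∑ j ∈ Finset.range k, genBinom (j - γ) j * ((x : ℂ) / τ) ^ j

def kernelIAdj (a b γ : ℂ) (k : ℕ) (x τ : ℝ) : ℂ :=
  Complex.Gamma (1 - γ) / (2 * Real.pi) *
    ((Complex.I * x - Complex.I * τ) ^ (γ - 1) / a +
      (Complex.I * τ - Complex.I * x) ^ (γ - 1) / b) -
  Complex.Gamma (1 - γ) / (2 * Real.pi) *
    ((Complex.I * x) ^ (γ - 1) / a + (-(Complex.I * x)) ^ (γ - 1) / b) *
      ∑ j ∈ Finset.range k, genBinom (j - γ) j * ((τ : ℂ) / x) ^ j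

/-! The generalized functions defined by the non-integer powers above, also across their
singular points, are boundary values: `± i y` is replaced by `ε ± i y` with `ε ↓ 0`. At `ε = 0`
the following three functions are the three kernels above. -/

def kernelDReg (a b γ : ℂ) (ε x τ : ℝ) : ℂ :=
  Complex.Gamma (γ + 1) / (2 * Real.pi) *
    (a / (ε + Complex.I * (τ - x)) ^ (γ + 1) +
      b / (ε + Complex.I * (x - τ)) ^ (γ + 1))

def kernelIReg (a b γ : ℂ) (k : ℕ) (ε x τ : ℝ) : ℂ :=
  Complex.Gamma (1 - γ) / (2 * Real.pi) *
    ((ε + Complex.I * (τ - x)) ^ (γ - 1) / a +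
      (ε + Complex.I * (x - τ)) ^ (γ - 1) / b) -
  Complex.Gamma (1 - γ) / (2 * Real.pi) *
    ∑ j ∈ Finset.range k, genBinom (j - γ) j *
      ((ε + Complex.I * τ) ^ (γ - 1) / a * (Complex.I * x / (ε + Complex.I * τ)) ^ j +
        (ε - Complex.I * τ) ^ (γ - 1) / b * (-(Complex.I * x) / (ε - Complex.I * τ)) ^ j)

def kernelIAdjReg (a b γ : ℂ) (k : ℕ) (ε x τ : ℝ) : ℂ :=
  Complex.Gamma (1 - γ) / (2 * Real.pi) *
    ((ε + Complex.I * (x - τ)) ^ (γ - 1) / a +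
      (ε + Complex.I * (τ - x)) ^ (γ - 1) / b) -
  Complex.Gamma (1 - γ) / (2 * Real.pi) *
    ∑ j ∈ Finset.range k, genBinom (j - γ) j *
      ((ε + Complex.I * x) ^ (γ - 1) / a * (Complex.I * τ / (ε + Complex.I * x)) ^ j +
        (ε - Complex.I * x) ^ (γ - 1) / b * (-(Complex.I * τ) / (ε - Complex.I * x)) ^ j)

end

end ComplexFrac

open ComplexFrac

/-!
All three operators come from one symbol, `h(ω)` times the exponential `e^{iωx}` without the first
`k` terms of its Taylor expansion: `k = 0` and `h` of degree `γ` for the derivative, `h` of degree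
`-γ` for the integrator. The Abel factor `e^{-ε|ω|}` makes every integral absolutely convergent, so
that by Fubini the damped operator has the inverse Fourier transform of the damped symbol as its
kernel. Splitting at `ω = 0`, this kernel is a sum of two Laplace transforms, at `ε ± iτ`, of
`t ^ s` times an exponential remainder. Each equals `Γ(s + 1)` times the Taylor remainder in `x` of
`(w - ix) ^ (-s - 1)`: differentiating in `x` raises `s` and lowers `k` on both sides, and `k = 0`
is the analytically continued Gamma integral.

As `ε ↓ 0`, dominated convergence applies on the Fourier side because `φ̂` is rapidly decreasing,
and on the kernel side wherever `φ` avoids the singularities of the kernel or `Re γ > 0` makes them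
integrable. The adjoint `I*` is reduced to `I` by Fubini, `⟨I* φ, ψ⟩ = ⟨φ, I ψ⟩`. Finally, the
operators send test functions to continuous functions of polynomial growth, so along a sequence of
bumps shrinking to `τ` the pairing with `ψ` converges to the transposed operator applied to `ψ`,
evaluated at `τ`; this gives the responses.
-/

namespace ComplexFrac

noncomputable section

/-- The remainder of the exponential series after `k` terms. -/
def expRem (k : ℕ) (z : ℂ) : ℂ :=
  Complex.exp z - ∑ j ∈ Finset.range k, z ^ j / (j.factorial : ℂ)

theorem expRem_zero (z : ℂ) : expRem 0 z = Complex.exp z := by simp [expRem]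

theorem expRem_succ_apply_zero (k : ℕ) : expRem (k + 1) 0 = 0 := by
  simp [expRem, Finset.sum_range_succ']

@[fun_prop]
theorem continuous_expRem (k : ℕ) : Continuous (expRem k) := by
  unfold expRem; fun_prop

@[fun_prop]
theorem measurable_expRem (k : ℕ) : Measurable (expRem k) := (continuous_expRem k).measurable

theorem hasDerivAt_expRem_succ (k : ℕ) (z : ℂ) :
    HasDerivAt (expRem (k + 1)) (expRem k z) z := by
  have hterm (j : ℕ) : HasDerivAt (fun z : ℂ => z ^ (j + 1) / ((j + 1).factorial : ℂ))
      (z ^ j / (j.factorial : ℂ)) z := by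
    refine ((hasDerivAt_pow (j + 1) z).div_const _).congr_deriv ?_
    have : (j.factorial : ℂ) ≠ 0 := by exact_mod_cast j.factorial_ne_zero
    have : (j : ℂ) + 1 ≠ 0 := by exact_mod_cast j.succ_ne_zero
    rw [Nat.factorial_succ]
    push_cast
    field_simp
  have hsum := HasDerivAt.fun_sum (u := Finset.range k) fun j _ => hterm j
  refine ((Complex.hasDerivAt_exp z).sub (hsum.add_const 1)).congr_of_eventuallyEq
    (Eventually.of_forall fun w => ?_)
  simp [expRem, Finset.sum_range_succ']

theorem norm_expRem_le_pow (k : ℕ) {z : ℂ} (hz : z.re ≤ 0) : ‖expRem k z‖ ≤ ‖z‖ ^ k := by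
  induction k generalizing z with
  | zero => simpa [expRem_zero, Complex.norm_exp] using hz
  | succ k ih =>
    have hderiv (t : ℝ) : HasDerivAt (fun t : ℝ => expRem (k + 1) (t * z))
        (expRem k (t * z) * z) t := by
      have hline : HasDerivAt (fun t : ℝ => (t : ℂ) * z) z t := by
        simpa using Complex.ofRealCLM.hasDerivAt.mul_const z
      exact (hasDerivAt_expRem_succ k _).comp t hline
    have hbound : ∀ t ∈ Set.Ico (0 : ℝ) 1, ‖expRem k (t * z) * z‖ ≤ ‖z‖ ^ (k + 1) := by
      rintro t ⟨ht0, ht1⟩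
      have hre : ((t : ℂ) * z).re ≤ 0 := by simpa using mul_nonpos_of_nonneg_of_nonpos ht0 hz
      have hle : ‖(t : ℂ) * z‖ ≤ ‖z‖ := by
        rw [norm_mul, Complex.norm_of_nonneg ht0]
        exact mul_le_of_le_one_left (norm_nonneg z) ht1.le
      rw [norm_mul, pow_succ]
      gcongr
      exact (ih hre).trans (by gcongr)
    have := norm_image_sub_le_of_norm_deriv_le_segment_01'
      (fun t _ => (hderiv t).hasDerivWithinAt) hbound
    simpa [expRem_succ_apply_zero] using this

theorem norm_expRem_I_mul_le (k : ℕ) (y : ℝ) : ‖expRem k (Complex.I * y)‖ ≤ |y| ^ k := by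
  simpa using norm_expRem_le_pow k (z := Complex.I * y) (by simp)

theorem norm_cpow_mul_expRem_mul_exp_neg_le (k : ℕ) (s w : ℂ) (x : ℝ) {t : ℝ} (ht : 0 < t) :
    ‖(t : ℂ) ^ s * expRem k (Complex.I * x * t) * Complex.exp (-(w * t))‖ ≤
      |x| ^ k * (t ^ (s.re + k) * Real.exp (-w.re * t)) := by
  have hrem : ‖expRem k (Complex.I * x * t)‖ ≤ |x| ^ k * t ^ k := by
    simpa [mul_assoc, abs_mul, abs_of_pos ht, mul_pow] using norm_expRem_I_mul_le k (x * t)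
  have hexp : ‖Complex.exp (-(w * t))‖ = Real.exp (-w.re * t) := by simp [Complex.norm_exp]
  rw [norm_mul, norm_mul, Complex.norm_cpow_eq_rpow_re_of_pos ht, hexp, Real.rpow_add ht,
    Real.rpow_natCast]
  calc _ ≤ t ^ s.re * (|x| ^ k * t ^ k) * Real.exp (-w.re * t) := by gcongr
    _ = _ := by ring

theorem integrableOn_cpow_mul_expRem_mul_exp_neg {k : ℕ} {s w : ℂ} (hs : -1 < s.re + k)
    (hw : 0 < w.re) (x : ℝ) :
    IntegrableOn (fun t : ℝ => (t : ℂ) ^ s * expRem k (Complex.I * x * t) *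
      Complex.exp (-(w * t))) (Set.Ioi 0) := by
  have hbound : IntegrableOn (fun t : ℝ => t ^ (s.re + k) * Real.exp (-w.re * t)) (Set.Ioi 0) := by
    simpa using integrableOn_rpow_mul_exp_neg_mul_rpow hs one_pos hw
  refine (hbound.const_mul (|x| ^ k)).mono' (by fun_prop : Measurable _).aestronglyMeasurable ?_
  filter_upwards [ae_restrict_mem measurableSet_Ioi] with t ht
  exact norm_cpow_mul_expRem_mul_exp_neg_le k s w x ht

theorem integrableOn_cpow_mul_exp_neg {s w : ℂ} (hs : -1 < s.re) (hw : 0 < w.re) :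
    IntegrableOn (fun t : ℝ => (t : ℂ) ^ s * Complex.exp (-(w * t))) (Set.Ioi 0) := by
  simpa [expRem_zero] using
    integrableOn_cpow_mul_expRem_mul_exp_neg (k := 0) (by simpa using hs) hw 0

theorem differentiableOn_integral_cpow_mul_exp_neg {s : ℂ} (hs : -1 < s.re) :
    DifferentiableOn ℂ
      (fun w => ∫ t : ℝ in Set.Ioi 0, (t : ℂ) ^ s * Complex.exp (-(w * t))) {w | 0 < w.re} := by
  intro w₀ (hw₀ : 0 < w₀.re)
  have hhalf : (0 : ℝ) < ((w₀.re / 2 : ℝ) : ℂ).re := by simpa using hw₀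
  have hs' : -1 < (s + 1).re := by simpa using hs.trans (lt_add_one _)
  refine ((hasDerivAt_integral_of_dominated_loc_of_deriv_le
    (μ := volume.restrict (Set.Ioi (0 : ℝ)))
    (F := fun w (t : ℝ) => (t : ℂ) ^ s * Complex.exp (-(w * t)))
    (F' := fun w (t : ℝ) => (t : ℂ) ^ s * (Complex.exp (-(w * t)) * (-t)))
    (bound := fun t : ℝ => ‖(t : ℂ) ^ (s + 1) * Complex.exp (-((w₀.re / 2 : ℝ) * t))‖)
    (s := {w : ℂ | w₀.re / 2 < w.re})
    ((isOpen_lt continuous_const Complex.continuous_re).mem_nhds (half_lt_self hw₀))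
    (Eventually.of_forall fun w => by fun_prop) (integrableOn_cpow_mul_exp_neg hs hw₀)
    (by fun_prop) ?_ (integrableOn_cpow_mul_exp_neg hs' hhalf).norm
    ?_).2).differentiableAt.differentiableWithinAt
  · filter_upwards [ae_restrict_mem measurableSet_Ioi] with t (ht : 0 < t) w (hw : _ < w.re)
    have hexp : ‖Complex.exp (-(w * t))‖ ≤ ‖Complex.exp (-((w₀.re / 2 : ℝ) * t))‖ := by
      simp only [Complex.norm_exp, Complex.neg_re, Complex.re_mul_ofReal, Complex.ofReal_re]
      gcongr
    rw [Complex.cpow_add _ _ (by exact_mod_cast ht.ne'), Complex.cpow_one, norm_mul, norm_mul,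
      norm_mul, norm_mul, norm_neg, mul_assoc, mul_comm ‖(t : ℂ)‖]
    gcongr
  · refine Eventually.of_forall fun t w _ => ?_
    exact (by simpa using ((hasDerivAt_id' w).mul_const (t : ℂ)).fun_neg :
      HasDerivAt (fun w : ℂ => -(w * t)) (-t) w).cexp.const_mul _

theorem integral_cpow_mul_exp_neg {s w : ℂ} (hs : 0 < s.re) (hw : 0 < w.re) :
    ∫ t : ℝ in Set.Ioi 0, (t : ℂ) ^ (s - 1) * Complex.exp (-(w * t)) =
      Complex.Gamma s * w ^ (-s) := by
  have hopen : IsOpen {w : ℂ | 0 < w.re} := isOpen_lt continuous_const Complex.continuous_re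
  have hleft := differentiableOn_integral_cpow_mul_exp_neg (s := s - 1) (by simpa using hs)
  have hright : DifferentiableOn ℂ (fun w : ℂ => Complex.Gamma s * w ^ (-s)) {w | 0 < w.re} :=
    fun w hw => ((differentiableAt_id.cpow_const (Or.inl hw)).const_mul _).differentiableWithinAt
  refine (hleft.analyticOnNhd hopen).eqOn_of_preconnected_of_frequently_eq
    (hright.analyticOnNhd hopen) (convex_halfSpace_re_gt 0).isPreconnected
    (z₀ := 1) (by simp) ?_ hw
  have hreal (r : ℝ) (hr : 0 < r) :
      ∫ t : ℝ in Set.Ioi 0, (t : ℂ) ^ (s - 1) * Complex.exp (-(r * t)) =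
        Complex.Gamma s * (r : ℂ) ^ (-s) := by
    rw [Complex.integral_cpow_mul_exp_neg_mul_Ioi hs hr, mul_comm, Complex.cpow_neg, one_div,
      Complex.inv_cpow _ _ (by simp [Complex.arg_ofReal_of_nonneg hr.le, Real.pi_ne_zero.symm])]
  have htendsto : Tendsto (fun r : ℝ => (r : ℂ)) (𝓝[>] 1) (𝓝[≠] 1) := by
    refine tendsto_nhdsWithin_iff.2 ⟨?_, ?_⟩
    · exact (Complex.continuous_ofReal.tendsto' 1 1 (by simp)).mono_left nhdsWithin_le_nhds
    · filter_upwards [self_mem_nhdsWithin] with r hr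
      simpa using ne_of_gt hr
  refine htendsto.frequently (Eventually.frequently ?_)
  filter_upwards [self_mem_nhdsWithin] with r hr using hreal r (zero_lt_one.trans hr)

/-- The closed form of the Laplace transform at `w` of `t ↦ t ^ s * expRem k (I * x * t)`. -/
def laplaceExpRem (k : ℕ) (s w : ℂ) (x : ℝ) : ℂ :=
  Complex.Gamma (s + 1) * ((w - Complex.I * x) ^ (-s - 1) -
    ∑ j ∈ Finset.range k, genBinom (j + s) j * (Complex.I * x) ^ j * w ^ (-s - 1 - j))

theorem succ_mul_genBinom_succ (z : ℂ) (j : ℕ) :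
    (j + 1) * genBinom z (j + 1) = (z - j) * genBinom z j := by
  have : (j : ℂ) + 1 ≠ 0 := by exact_mod_cast j.succ_ne_zero
  have : (j.factorial : ℂ) ≠ 0 := by exact_mod_cast j.factorial_ne_zero
  rw [genBinom, genBinom, Finset.prod_range_succ, Nat.factorial_succ]
  push_cast
  field_simp

theorem laplaceExpRem_succ_apply_zero (k : ℕ) (s w : ℂ) : laplaceExpRem (k + 1) s w 0 = 0 := by
  simp [laplaceExpRem, Finset.sum_range_succ', genBinom]

theorem hasDerivAt_laplaceExpRem_succ (k : ℕ) {s w : ℂ} (hs : s + 1 ≠ 0) (hw : 0 < w.re) (x : ℝ) :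
    HasDerivAt (laplaceExpRem (k + 1) s w) (Complex.I * laplaceExpRem k (s + 1) w x) x := by
  have hline : HasDerivAt (fun x : ℝ => Complex.I * (x : ℂ)) Complex.I x := by
    simpa using Complex.ofRealCLM.hasDerivAt.const_mul Complex.I
  have hpow : HasDerivAt (fun x : ℝ => (w - Complex.I * x) ^ (-s - 1))
      ((-s - 1) * (w - Complex.I * x) ^ (-s - 1 - 1) * (-Complex.I)) x := by
    have hslit : w - Complex.I * x ∈ Complex.slitPlane := Or.inl (by simpa using hw)
    simpa [Function.comp_def] using
      ((hasDerivAt_id _).cpow_const (c := -s - 1) hslit).comp x (hline.const_sub w)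
  have hterm (j : ℕ) : HasDerivAt
      (fun x : ℝ => genBinom ((j + 1 : ℕ) + s) (j + 1) * (Complex.I * x) ^ (j + 1) *
        w ^ (-s - 1 - (j + 1 : ℕ)))
      ((s + 1) * Complex.I * (genBinom (j + (s + 1)) j * (Complex.I * x) ^ j *
        w ^ (-(s + 1) - 1 - j))) x := by
    refine (((hline.fun_pow (j + 1)).const_mul _).mul_const _).congr_deriv ?_
    have := succ_mul_genBinom_succ (j + (s + 1)) j
    push_cast
    rw [show (j : ℂ) + 1 + s = j + (s + 1) by ring,
      show -s - 1 - ((j : ℂ) + 1) = -(s + 1) - 1 - j by ring]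
    linear_combination (Complex.I * x) ^ j * Complex.I * w ^ (-(s + 1) - 1 - j) * this
  have hsum := (HasDerivAt.fun_sum (u := Finset.range k) fun j _ => hterm j).add_const
    (genBinom ((0 : ℕ) + s) 0 * w ^ (-s - 1))
  refine (((hpow.sub hsum).const_mul (Complex.Gamma (s + 1))).congr_deriv ?_).congr_of_eventuallyEq
    (Eventually.of_forall fun y => by simp [laplaceExpRem, Finset.sum_range_succ'])
  rw [laplaceExpRem, Complex.Gamma_add_one (s + 1) hs, ← Finset.mul_sum,
    show -s - 1 - 1 = -(s + 1) - 1 by ring]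
  ring

theorem hasDerivAt_integral_expRem_succ {k : ℕ} {s w : ℂ} (hs : -1 < (s + 1).re + k)
    (hw : 0 < w.re) (x : ℝ) :
    HasDerivAt
      (fun x : ℝ => ∫ t : ℝ in Set.Ioi 0,
        (t : ℂ) ^ s * expRem (k + 1) (Complex.I * x * t) * Complex.exp (-(w * t)))
      (Complex.I * ∫ t : ℝ in Set.Ioi 0,
        (t : ℂ) ^ (s + 1) * expRem k (Complex.I * x * t) * Complex.exp (-(w * t))) x := by
  have hs' : -1 < s.re + (k + 1 : ℕ) := by
    push_cast
    linarith [Complex.add_re s 1, Complex.one_re]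
  have hbound : IntegrableOn
      (fun t : ℝ => t ^ ((s + 1).re + k) * Real.exp (-w.re * t)) (Set.Ioi 0) := by
    simpa using integrableOn_rpow_mul_exp_neg_mul_rpow hs one_pos hw
  rw [← integral_const_mul]
  refine (hasDerivAt_integral_of_dominated_loc_of_deriv_le
    (μ := volume.restrict (Set.Ioi (0 : ℝ)))
    (F := fun (x t : ℝ) =>
      (t : ℂ) ^ s * expRem (k + 1) (Complex.I * x * t) * Complex.exp (-(w * t)))
    (F' := fun (x t : ℝ) => Complex.I *
      ((t : ℂ) ^ (s + 1) * expRem k (Complex.I * x * t) * Complex.exp (-(w * t))))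
    (bound := fun t => (|x| + 1) ^ k * (t ^ ((s + 1).re + k) * Real.exp (-w.re * t)))
    (Metric.ball_mem_nhds x one_pos)
    (Eventually.of_forall fun y => (by fun_prop : Measurable _).aestronglyMeasurable)
    (integrableOn_cpow_mul_expRem_mul_exp_neg hs' hw x)
    (by fun_prop : Measurable _).aestronglyMeasurable ?_
    (hbound.const_mul _) ?_).2
  · filter_upwards [ae_restrict_mem measurableSet_Ioi] with t (ht : 0 < t) y hy
    have hy : |y| ≤ |x| + 1 := by
      have : |y - x| < 1 := by simpa [Real.dist_eq] using hy
      linarith [abs_sub_abs_le_abs_sub y x]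
    rw [norm_mul, Complex.norm_I, one_mul]
    exact (norm_cpow_mul_expRem_mul_exp_neg_le k _ w y ht).trans (by gcongr)
  · filter_upwards [ae_restrict_mem measurableSet_Ioi] with t (ht : 0 < t) y _
    have hline : HasDerivAt (fun y : ℝ => Complex.I * y * t) (Complex.I * t) y := by
      simpa using (Complex.ofRealCLM.hasDerivAt.const_mul Complex.I).mul_const (t : ℂ)
    refine ((((hasDerivAt_expRem_succ k _).comp y hline).const_mul _).mul_const _).congr_deriv ?_
    rw [Complex.cpow_add _ _ (by exact_mod_cast ht.ne'), Complex.cpow_one]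
    ring

/-- Both sides satisfy the same differential recursion in `x`, which raises `s` as it lowers `k`. -/
theorem integral_cpow_mul_expRem_mul_exp_neg {k : ℕ} {s w : ℂ} (hs : ∀ n : ℕ, s + 1 ≠ -n)
    (hk : -1 < s.re + k) (hw : 0 < w.re) (x : ℝ) :
    ∫ t : ℝ in Set.Ioi 0,
      (t : ℂ) ^ s * expRem k (Complex.I * x * t) * Complex.exp (-(w * t)) =
        laplaceExpRem k s w x := by
  induction k generalizing s x with
  | zero =>
    have := integral_cpow_mul_exp_neg (s := s + 1) (w := w - Complex.I * x)
      (by simpa [neg_lt_iff_pos_add] using hk) (by simpa using hw)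
    have hexp (t : ℝ) : Complex.exp (Complex.I * x * t) * Complex.exp (-(w * t)) =
        Complex.exp (-((w - Complex.I * x) * t)) := by
      rw [← Complex.exp_add]; ring_nf
    rw [add_sub_cancel_right, neg_add'] at this
    simpa [laplaceExpRem, expRem_zero, mul_assoc, ← hexp] using this
  | succ k ih =>
    have hs' (n : ℕ) : s + 1 + 1 ≠ -n := fun h =>
      hs (n + 1) (by push_cast; linear_combination h)
    have hk' : -1 < (s + 1).re + k := by
      push_cast at hk
      linarith [Complex.add_re s 1, Complex.one_re]
    have hderiv (y : ℝ) := (hasDerivAt_integral_expRem_succ hk' hw y).sub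
      (hasDerivAt_laplaceExpRem_succ k (by simpa using hs 0) hw y)
    have hconst := is_const_of_deriv_eq_zero (fun y => (hderiv y).differentiableAt)
      (fun y => by rw [(hderiv y).deriv, ih hs' hk', sub_self]) x 0
    simpa [laplaceExpRem_succ_apply_zero, expRem_succ_apply_zero, sub_eq_zero] using hconst

section RemSymbol

variable (a b s : ℂ) (k : ℕ)

@[fun_prop]
theorem measurable_homMult : Measurable (homMult a b s) := by
  unfold homMult
  refine Measurable.ite measurableSet_Ioi (by fun_prop) ?_
  exact Measurable.ite measurableSet_Iio (by fun_prop) measurable_const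

theorem homMult_of_pos {t : ℝ} (ht : 0 < t) : homMult a b s t = a * (t : ℂ) ^ s := by
  simp [homMult, ht]

theorem homMult_zero : homMult a b s 0 = 0 := by simp [homMult]

theorem homMult_neg (ω : ℝ) : homMult a b s (-ω) = homMult b a s ω := by
  rcases lt_trichotomy ω 0 with h | rfl | h
  · simp [homMult, h, h.le]
  · simp [homMult_zero]
  · simp [homMult, h, h.le]

theorem inv_homMult (ω : ℝ) : (homMult a b s ω)⁻¹ = homMult a⁻¹ b⁻¹ (-s) ω := by
  unfold homMult
  split_ifs <;> simp [Complex.cpow_neg, mul_comm]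

theorem norm_homMult_le {ω : ℝ} (hω : ω ≠ 0) :
    ‖homMult a b s ω‖ ≤ (‖a‖ + ‖b‖) * |ω| ^ s.re := by
  wlog h : 0 < ω generalizing a b ω
  · have := this b a (neg_ne_zero.2 hω) (neg_pos.2 (lt_of_le_of_ne (not_lt.1 h) hω))
    rwa [homMult_neg, abs_neg, add_comm] at this
  rw [homMult_of_pos _ _ _ h, norm_mul, Complex.norm_cpow_eq_rpow_re_of_pos h, abs_of_pos h]
  gcongr
  exact le_add_of_nonneg_right (norm_nonneg b)

/-- The homogeneous multiplier of degree `s`, applied to the exponential `ω ↦ e^{iωx}` without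
the first `k` terms of its Taylor expansion. With `k = 0` and `s = γ` it is the integrand of the
derivative of order `γ`, with `s = -γ` that of the integrator. -/
def remSymbol (x ω : ℝ) : ℂ := homMult a b s ω * expRem k (Complex.I * x * ω)

@[fun_prop]
theorem measurable_remSymbol : Measurable fun p : ℝ × ℝ => remSymbol a b s k p.1 p.2 := by
  unfold remSymbol; fun_prop

theorem remSymbol_neg (x ω : ℝ) : remSymbol a b s k x (-ω) = remSymbol b a s k (-x) ω := by
  simp [remSymbol, homMult_neg]

theorem remSymbol_of_pos (x : ℝ) {t : ℝ} (ht : 0 < t) :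
    remSymbol a b s k x t = a * ((t : ℂ) ^ s * expRem k (Complex.I * x * t)) := by
  rw [remSymbol, homMult_of_pos _ _ _ ht, mul_assoc]

theorem norm_remSymbol_le (x ω : ℝ) :
    ‖remSymbol a b s k x ω‖ ≤ (‖a‖ + ‖b‖) * |x| ^ k * |ω| ^ (s.re + k) := by
  rcases eq_or_ne ω 0 with rfl | hω
  · rw [remSymbol, homMult_zero, zero_mul, norm_zero]
    positivity
  have hrem : ‖expRem k (Complex.I * x * ω)‖ ≤ |x| ^ k * |ω| ^ k := by
    simpa [mul_assoc, abs_mul, mul_pow] using norm_expRem_I_mul_le k (x * ω)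
  rw [remSymbol, norm_mul, Real.rpow_add (abs_pos.2 hω), Real.rpow_natCast]
  calc _ ≤ (‖a‖ + ‖b‖) * |ω| ^ s.re * (|x| ^ k * |ω| ^ k) := by
        gcongr
        exact norm_homMult_le a b s hω
    _ = _ := by ring

/-- The inverse Fourier transform of `remSymbol`, with the `x`-dependence of the symbol kept, in
closed form: the exponential damping `e^{-ε|ω|}` moves the two boundary values to `ε ± iτ`. -/
def remKernel (ε x τ : ℝ) : ℂ :=
  1 / (2 * Real.pi) * (a * laplaceExpRem k s (ε + Complex.I * τ) x +
    b * laplaceExpRem k s (ε - Complex.I * τ) (-x))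

theorem kernelIReg_eq_remKernel (γ : ℂ) {ε τ : ℝ} (hετ : ε ≠ 0 ∨ τ ≠ 0) (x : ℝ) :
    kernelIReg a b γ k ε x τ = remKernel a⁻¹ b⁻¹ (-γ) k ε x τ := by
  have hterm {z : ℂ} (hz : z ≠ 0) (u : ℂ) (j : ℕ) :
      z ^ (γ - 1) * (u / z) ^ j = u ^ j * z ^ (γ - 1 - j) := by
    rw [Complex.cpow_sub (γ - 1) _ hz, Complex.cpow_natCast, div_pow]
    ring
  have hpos : (ε : ℂ) + Complex.I * τ ≠ 0 := fun h => by
    simpa using hετ.imp (· (by simpa using congrArg Complex.re h))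
      (· (by simpa using congrArg Complex.im h))
  have hneg : (ε : ℂ) - Complex.I * τ ≠ 0 := fun h => by
    simpa using hετ.imp (· (by simpa using congrArg Complex.re h))
      (· (by simpa using congrArg Complex.im h))
  simp only [kernelIReg, remKernel, laplaceExpRem, neg_neg, sub_neg_eq_add, ← sub_eq_add_neg,
    Complex.ofReal_neg, mul_neg, div_mul_eq_mul_div, hterm hpos, hterm hneg]
  rw [show (-γ + 1 : ℂ) = 1 - γ by ring, mul_sub (Complex.Gamma _), mul_sub (Complex.Gamma _),
    show (ε : ℂ) + Complex.I * τ - Complex.I * x = ε + Complex.I * (τ - x) by ring,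
    show (ε : ℂ) - Complex.I * τ + Complex.I * x = ε + Complex.I * (x - τ) by ring]
  simp only [mul_add, mul_sub, Finset.sum_add_distrib, div_eq_mul_inv, Finset.mul_sum]
  ring_nf

theorem kernelDReg_eq_remKernel (γ : ℂ) (ε x τ : ℝ) :
    kernelDReg a b γ ε x τ = remKernel a b γ 0 ε x τ := by
  simp only [kernelDReg, remKernel, laplaceExpRem, div_eq_mul_inv, ← Complex.cpow_neg,
    Finset.range_zero, Finset.sum_empty, sub_zero, Complex.ofReal_neg, mul_neg, sub_neg_eq_add]
  ring_nf

theorem kernelI_eq_kernelIReg_zero (γ : ℂ) (x τ : ℝ) :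
    kernelI a b γ k x τ = kernelIReg a b γ k 0 x τ := by
  simp only [kernelI, kernelIReg, Complex.ofReal_zero, zero_add, zero_sub, neg_div_neg_eq,
    mul_div_mul_left _ _ Complex.I_ne_zero, mul_sub]
  rw [mul_assoc, Finset.mul_sum]
  congr 2
  exact Finset.sum_congr rfl fun j _ => by ring

theorem kernelD_eq_kernelDReg_zero (γ : ℂ) (x τ : ℝ) :
    kernelD a b γ x τ = kernelDReg a b γ 0 x τ := by
  simp [kernelD, kernelDReg, mul_sub]

theorem kernelIAdj_eq_kernelI (γ : ℂ) (x τ : ℝ) :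
    kernelIAdj a b γ k x τ = kernelI a b γ k τ x := rfl

theorem kernelIAdjReg_eq_kernelIReg (γ : ℂ) (ε x τ : ℝ) :
    kernelIAdjReg a b γ k ε x τ = kernelIReg a b γ k ε τ x := rfl

end RemSymbol

theorem integrable_of_integrableOn_Ioi {E : Type*} [NormedAddCommGroup E] {f : ℝ → E}
    (hpos : IntegrableOn f (Set.Ioi 0)) (hneg : IntegrableOn (fun t => f (-t)) (Set.Ioi 0)) :
    Integrable f := by
  rw [← integrableOn_univ, ← Set.Iic_union_Ioi (a := (0 : ℝ)), integrableOn_union,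
    integrableOn_Iic_iff_integrableOn_Iio]
  refine ⟨((Measure.measurePreserving_neg volume).integrableOn_comp_preimage
    (Homeomorph.neg ℝ).measurableEmbedding).1 ?_, hpos⟩
  simpa [Function.comp_def] using hneg

theorem integral_eq_integral_Ioi_add_integral_Ioi_neg {E : Type*} [NormedAddCommGroup E]
    [NormedSpace ℝ E] {f : ℝ → E} (hf : Integrable f) :
    ∫ x, f x = (∫ t in Set.Ioi 0, f t) + ∫ t in Set.Ioi 0, f (-t) := by
  rw [integral_comp_neg_Ioi, neg_zero, add_comm,
    intervalIntegral.integral_Iic_add_Ioi hf.integrableOn hf.integrableOn]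

theorem integrable_abs_rpow_mul_exp_neg {p ε : ℝ} (hp : -1 < p) (hε : 0 < ε) :
    Integrable fun ω : ℝ => |ω| ^ p * Real.exp (-|ε * ω|) := by
  have hpos : IntegrableOn (fun ω : ℝ => |ω| ^ p * Real.exp (-|ε * ω|)) (Set.Ioi 0) := by
    refine IntegrableOn.congr_fun (integrableOn_rpow_mul_exp_neg_mul_rpow hp one_pos hε)
      (fun ω (hω : 0 < ω) => ?_) measurableSet_Ioi
    simp only [abs_of_pos hω, abs_of_pos (mul_pos hε hω), Real.rpow_one, neg_mul]
  exact integrable_of_integrableOn_Ioi hpos (by simpa using hpos)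

@[fun_prop]
theorem continuous_fourierDirac : Continuous fun p : ℝ × ℝ => fourierDirac p.1 p.2 := by
  unfold fourierDirac; fun_prop

theorem norm_fourierDirac (τ ω : ℝ) : ‖fourierDirac τ ω‖ = 1 := by
  simp [fourierDirac, Complex.norm_exp]

theorem fourierDirac_neg (τ ω : ℝ) : fourierDirac τ (-ω) = fourierDirac (-τ) ω := by
  simp [fourierDirac]

section DampedSymbol

variable (a b s : ℂ) (k : ℕ)

/-- The symbol `remSymbol` with the Abel damping `e^{-|εω|}`. -/
def dampedSymbol (ε x ω : ℝ) : ℂ := remSymbol a b s k x ω * Real.exp (-|ε * ω|)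

@[fun_prop]
theorem measurable_dampedSymbol :
    Measurable fun p : ℝ × ℝ × ℝ => dampedSymbol a b s k p.1 p.2.1 p.2.2 := by
  unfold dampedSymbol; fun_prop

theorem dampedSymbol_zero (x ω : ℝ) : dampedSymbol a b s k 0 x ω = remSymbol a b s k x ω := by
  simp [dampedSymbol]

theorem dampedSymbol_neg (ε x ω : ℝ) :
    dampedSymbol a b s k ε x (-ω) = dampedSymbol b a s k ε (-x) ω := by
  simp [dampedSymbol, remSymbol_neg]

theorem norm_dampedSymbol_le_mul_exp (ε x ω : ℝ) :
    ‖dampedSymbol a b s k ε x ω‖ ≤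
      (‖a‖ + ‖b‖) * |x| ^ k * (|ω| ^ (s.re + k) * Real.exp (-|ε * ω|)) := by
  rw [dampedSymbol, norm_mul, Complex.norm_of_nonneg (Real.exp_pos _).le, ← mul_assoc]
  gcongr
  exact norm_remSymbol_le a b s k x ω

theorem norm_dampedSymbol_le (ε x ω : ℝ) :
    ‖dampedSymbol a b s k ε x ω‖ ≤ (‖a‖ + ‖b‖) * |x| ^ k * |ω| ^ (s.re + k) := by
  refine (norm_dampedSymbol_le_mul_exp a b s k ε x ω).trans ?_
  gcongr
  exact mul_le_of_le_one_right (by positivity)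
    (Real.exp_le_one_iff.2 (neg_nonpos.2 (abs_nonneg _)))

theorem dampedSymbol_mul_fourierDirac_of_pos {ε : ℝ} (hε : 0 < ε) (x τ : ℝ) {t : ℝ}
    (ht : 0 < t) : dampedSymbol a b s k ε x t * fourierDirac τ t = a * ((t : ℂ) ^ s *
      expRem k (Complex.I * x * t) * Complex.exp (-((ε + Complex.I * τ) * t))) := by
  rw [dampedSymbol, remSymbol_of_pos _ _ _ _ _ ht, fourierDirac, abs_of_pos (mul_pos hε ht),
    show -((ε + Complex.I * τ) * t) = ((-(ε * t) : ℝ) : ℂ) + -(Complex.I * t * τ) by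
      push_cast; ring, Complex.exp_add, Complex.ofReal_exp]
  ring

section Integral

variable {s k} (hk : -1 < s.re + k) {ε : ℝ} (hε : 0 < ε) (x τ : ℝ)

include hk hε in
theorem integrable_dampedSymbol_mul_fourierDirac :
    Integrable fun ω => dampedSymbol a b s k ε x ω * fourierDirac τ ω := by
  refine ((integrable_abs_rpow_mul_exp_neg hk hε).const_mul ((‖a‖ + ‖b‖) * |x| ^ k)).mono'
    (by fun_prop : Measurable _).aestronglyMeasurable (ae_of_all _ fun ω => ?_)
  rw [norm_mul, norm_fourierDirac, mul_one]
  exact norm_dampedSymbol_le_mul_exp a b s k ε x ω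

variable (hs : ∀ n : ℕ, s + 1 ≠ -n)

include hs hk hε in
theorem integral_Ioi_dampedSymbol_mul_fourierDirac :
    ∫ ω in Set.Ioi 0, dampedSymbol a b s k ε x ω * fourierDirac τ ω =
      a * laplaceExpRem k s (ε + Complex.I * τ) x := by
  rw [← integral_cpow_mul_expRem_mul_exp_neg hs hk (by simpa using hε), ← integral_const_mul]
  exact setIntegral_congr_fun measurableSet_Ioi fun _ ht =>
    dampedSymbol_mul_fourierDirac_of_pos a b s k hε x τ ht

include hs hk hε in
theorem integral_dampedSymbol_mul_fourierDirac :
    1 / (2 * Real.pi) * ∫ ω, dampedSymbol a b s k ε x ω * fourierDirac τ ω =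
      remKernel a b s k ε x τ := by
  rw [integral_eq_integral_Ioi_add_integral_Ioi_neg
    (integrable_dampedSymbol_mul_fourierDirac a b hk hε x τ)]
  simp only [dampedSymbol_neg, fourierDirac_neg]
  rw [integral_Ioi_dampedSymbol_mul_fourierDirac a b hk hε x τ hs,
    integral_Ioi_dampedSymbol_mul_fourierDirac b a hk hε (-x) (-τ) hs, remKernel]
  simp only [Complex.ofReal_neg, mul_neg, ← sub_eq_add_neg]

include hk hε hs in
theorem norm_remKernel_le :
    ‖remKernel a b s k ε x τ‖ ≤ 1 / (2 * Real.pi) * (‖a‖ + ‖b‖) *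
      (∫ ω : ℝ, |ω| ^ (s.re + k) * Real.exp (-|ε * ω|)) * |x| ^ k := by
  rw [← integral_dampedSymbol_mul_fourierDirac a b hk hε x τ hs, norm_mul]
  calc _ ≤ 1 / (2 * Real.pi) * ∫ ω : ℝ, (‖a‖ + ‖b‖) * |x| ^ k *
        (|ω| ^ (s.re + k) * Real.exp (-|ε * ω|)) := by
        gcongr
        · simp [abs_of_pos Real.pi_pos]
        · refine norm_integral_le_of_norm_le ((integrable_abs_rpow_mul_exp_neg hk hε).const_mul _)
            (ae_of_all _ fun ω => ?_)
          rw [norm_mul, norm_fourierDirac, mul_one]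
          exact norm_dampedSymbol_le_mul_exp a b s k ε x ω
    _ = _ := by rw [integral_const_mul]; ring

end Integral

end DampedSymbol

section Weight

variable {E : Type*} [NormedAddCommGroup E]

/-- The weight `(1 + ‖x‖²)^N` against which tempered functions are measured. -/
def temperWeight (N : ℕ) (x : E) : ℝ := (1 + ‖x‖ ^ 2) ^ N

@[fun_prop]
theorem continuous_temperWeight (N : ℕ) : Continuous fun x : E => temperWeight N x := by
  unfold temperWeight; fun_prop

@[fun_prop]
theorem hasTemperateGrowth_temperWeight {E : Type*} [NormedAddCommGroup E] [InnerProductSpace ℝ E]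
    (N : ℕ) : (fun x : E => temperWeight N x).HasTemperateGrowth := by
  unfold temperWeight; fun_prop

theorem temperWeight_pos (N : ℕ) (x : E) : 0 < temperWeight N x := by
  unfold temperWeight; positivity

theorem temperWeight_mono (x : E) : Monotone (temperWeight · x) := fun _ _ h =>
  pow_le_pow_right₀ (by nlinarith [sq_nonneg ‖x‖]) h

theorem temperWeight_neg (N : ℕ) (x : E) : temperWeight N (-x) = temperWeight N x := by
  simp [temperWeight]

/-- Peetre's inequality. -/
theorem temperWeight_sub_le (N : ℕ) (x y : E) :
    temperWeight N (x - y) ≤ 2 ^ N * temperWeight N x * temperWeight N y := by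
  unfold temperWeight
  rw [← mul_pow, ← mul_pow]
  gcongr
  nlinarith [norm_sub_le x y, norm_nonneg (x - y), sq_nonneg (‖x‖ - ‖y‖),
    sq_nonneg (‖x‖ * ‖y‖), norm_nonneg x, norm_nonneg y]

end Weight

/-- A function that becomes integrable upon division by a power of `1 + ‖x‖²`, so that it is the
density of a tempered distribution. -/
def IsTempered {E : Type*} [NormedAddCommGroup E] [MeasurableSpace E] (g : E → ℂ)
    (μ : Measure E := by volume_tac) : Prop :=
  ∃ N : ℕ, Integrable (fun x => (temperWeight N x)⁻¹ • g x) μ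

namespace IsTempered

section Closure

variable {E : Type*} [NormedAddCommGroup E] [MeasurableSpace E] {μ : Measure E} {f g : E → ℂ}

theorem const_mul (hf : IsTempered f μ) (c : ℂ) : IsTempered (fun x => c * f x) μ :=
  hf.imp fun N hN => by simpa only [mul_smul_comm] using hN.const_mul c

variable [OpensMeasurableSpace E]

theorem aestronglyMeasurable (hg : IsTempered g μ) : AEStronglyMeasurable g μ := by
  obtain ⟨N, hN⟩ := hg
  have hw : Measurable fun x : E => temperWeight N x := by fun_prop
  refine (hw.aestronglyMeasurable.smul hN.1).congr (ae_of_all _ fun x => ?_)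
  exact smul_inv_smul₀ (temperWeight_pos N x).ne' (g x)

theorem mono (hg : IsTempered g μ) (hf : AEStronglyMeasurable f μ)
    (hfg : ∀ᵐ x ∂μ, ‖f x‖ ≤ ‖g x‖) : IsTempered f μ := by
  obtain ⟨N, hN⟩ := hg
  have hw : Measurable fun x : E => (temperWeight N x)⁻¹ := by fun_prop
  refine ⟨N, hN.mono (hw.aestronglyMeasurable.smul hf) ?_⟩
  filter_upwards [hfg] with x hx
  rw [norm_smul, norm_smul]
  gcongr

theorem eventually_integrable (hg : IsTempered g μ) :
    ∀ᶠ N in atTop, Integrable (fun x => (temperWeight N x)⁻¹ • g x) μ := by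
  obtain ⟨N, hN⟩ := id hg
  filter_upwards [eventually_ge_atTop N] with M hNM
  have hw : Measurable fun x : E => (temperWeight M x)⁻¹ := by fun_prop
  refine hN.mono (hw.aestronglyMeasurable.smul hg.aestronglyMeasurable) (ae_of_all _ fun x => ?_)
  have := temperWeight_pos N x
  have := temperWeight_pos M x
  rw [norm_smul, norm_smul, Real.norm_of_nonneg (by positivity),
    Real.norm_of_nonneg (by positivity)]
  gcongr
  exact temperWeight_mono x hNM

theorem add (hf : IsTempered f μ) (hg : IsTempered g μ) : IsTempered (fun x => f x + g x) μ := by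
  obtain ⟨N, hfN, hgN⟩ := (hf.eventually_integrable.and hg.eventually_integrable).exists
  exact ⟨N, by simpa only [smul_add] using Integrable.fun_add hfN hgN⟩

theorem sum {ι : Type*} {s : Finset ι} {f : ι → E → ℂ} (hf : ∀ i ∈ s, IsTempered (f i) μ) :
    IsTempered (fun x => ∑ i ∈ s, f i x) μ := by
  simp_rw [← Finset.sum_apply]
  exact Finset.sum_induction f (IsTempered · μ) (fun _ _ => add) ⟨0, by simp⟩ hf

theorem comp_sub_right [MeasurableAdd E] [μ.IsAddRightInvariant] (hf : IsTempered f μ) (t : E) :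
    IsTempered (fun x => f (x - t)) μ := by
  obtain ⟨N, hN⟩ := id hf
  have hw : Measurable fun x : E => (temperWeight N x)⁻¹ := by fun_prop
  have hft := hf.aestronglyMeasurable.comp_measurePreserving (measurePreserving_sub_right μ t)
  refine ⟨N, ((hN.comp_sub_right t).smul (2 ^ N * temperWeight N t)).mono
    (hw.aestronglyMeasurable.smul hft) (ae_of_all _ fun x => ?_)⟩
  have := temperWeight_pos N x
  have := temperWeight_pos N (x - t)
  have := temperWeight_pos N t
  rw [Pi.smul_apply, smul_smul, norm_smul, norm_smul, Real.norm_of_nonneg (by positivity),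
    Real.norm_of_nonneg (by positivity)]
  refine mul_le_mul_of_nonneg_right ?_ (norm_nonneg _)
  rw [← div_eq_mul_inv, le_div_iff₀ ‹_›, inv_mul_le_iff₀ ‹_›]
  exact (temperWeight_sub_le N x t).trans_eq (by ring)

end Closure

section Schwartz

variable {E : Type*} [NormedAddCommGroup E] [InnerProductSpace ℝ E]

/-- The Schwartz function `(1 + ‖x‖²)^N φ(x)`. -/
def temperWeightMul (N : ℕ) (φ : 𝓢(E, ℂ)) : 𝓢(E, ℂ) :=
  SchwartzMap.smulLeftCLM ℂ (fun x : E => (temperWeight N x : ℂ)) φ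

theorem temperWeightMul_apply (N : ℕ) (φ : 𝓢(E, ℂ)) (x : E) :
    temperWeightMul N φ x = temperWeight N x * φ x :=
  SchwartzMap.smulLeftCLM_apply_apply
    (Complex.ofRealCLM.hasTemperateGrowth.comp (hasTemperateGrowth_temperWeight N)) φ x

theorem norm_temperWeightMul (N : ℕ) (φ : 𝓢(E, ℂ)) (x : E) :
    ‖temperWeightMul N φ x‖ = temperWeight N x * ‖φ x‖ := by
  rw [temperWeightMul_apply, norm_mul, Complex.norm_of_nonneg (temperWeight_pos N x).le]

theorem inv_smul_mul_temperWeightMul (N : ℕ) (z : ℂ) (φ : 𝓢(E, ℂ)) (x : E) :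
    (temperWeight N x)⁻¹ • z * temperWeightMul N φ x = z * φ x := by
  have : (temperWeight N x : ℂ) ≠ 0 := by exact_mod_cast (temperWeight_pos N x).ne'
  rw [temperWeightMul_apply, Complex.real_smul]
  push_cast
  field_simp

variable [MeasurableSpace E] [BorelSpace E] {μ : Measure E} {g : E → ℂ}

theorem integrable_mul (hg : IsTempered g μ) (φ : 𝓢(E, ℂ)) :
    Integrable (fun x => g x * φ x) μ := by
  obtain ⟨N, hN⟩ := hg
  exact (hN.mul_bdd (temperWeightMul N φ).continuous.aestronglyMeasurable
    (ae_of_all _ (SchwartzMap.norm_le_seminorm ℝ _))).congr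
      (ae_of_all _ fun x => inv_smul_mul_temperWeightMul N (g x) φ x)

theorem exists_distribution [μ.HasTemperateGrowth] (hg : IsTempered g μ) :
    ∃ U : 𝓢'(E, ℂ), ∀ φ : 𝓢(E, ℂ), U φ = ∫ x, g x * φ x ∂μ := by
  obtain ⟨N, hN⟩ := hg
  refine ⟨TemperedDistribution.smulLeftCLM ℂ (fun x : E => (temperWeight N x : ℂ))
    (Lp.toTemperedDistribution (μ := μ) (p := 1) hN.toL1), fun φ => ?_⟩
  rw [TemperedDistribution.smulLeftCLM_apply_apply, Lp.toTemperedDistribution_apply]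
  refine integral_congr_ae (hN.coeFn_toL1.mono fun x hx => ?_)
  simp only [hx]
  rw [smul_eq_mul, mul_comm]
  exact inv_smul_mul_temperWeightMul N (g x) φ x

section Haar

variable [μ.IsAddLeftInvariant]

theorem integrable_comp_sub_mul_mul [SecondCountableTopology E] [SFinite μ]
    [μ.HasTemperateGrowth] (hg : IsTempered g μ) (φ ψ : 𝓢(E, ℂ)) :
    Integrable (fun p : E × E => g (p.1 - p.2) * (φ p.1 * ψ p.2)) (μ.prod μ) := by
  obtain ⟨N, hN⟩ := id hg
  have hmeas : AEStronglyMeasurable (fun p : E × E => g (p.1 - p.2) * (φ p.1 * ψ p.2))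
      (μ.prod μ) := by
    have hφ : Continuous fun p : E × E => φ p.1 := φ.continuous.comp continuous_fst
    refine ((ψ.continuous.aestronglyMeasurable.convolution_integrand
      (ContinuousLinearMap.mul ℝ ℂ) hg.aestronglyMeasurable).mul hφ.aestronglyMeasurable).congr
      (ae_of_all _ fun p => ?_)
    simp only [ContinuousLinearMap.mul_apply', Pi.mul_apply]
    ring
  have hψ : Integrable (temperWeightMul N ψ) μ := SchwartzMap.integrable _
  have hbound := (hψ.convolution_integrand
    (ContinuousLinearMap.mul ℝ ℂ) hN).mul_bdd
      ((temperWeightMul N φ).continuous.comp continuous_fst).aestronglyMeasurable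
      (ae_of_all _ fun p => SchwartzMap.norm_le_seminorm ℝ _ p.1)
  refine (hbound.const_mul (2 ^ N)).mono hmeas (ae_of_all _ fun p => ?_)
  have := temperWeight_pos N (p.1 - p.2)
  simp only [ContinuousLinearMap.mul_apply', norm_mul, norm_smul, norm_pow,
    Complex.norm_ofNat, Function.comp_apply, norm_temperWeightMul]
  rw [Real.norm_of_nonneg (by positivity)]
  calc ‖g (p.1 - p.2)‖ * (‖φ p.1‖ * ‖ψ p.2‖)
      = temperWeight N (p.1 - p.2) * (‖φ p.1‖ * ‖ψ p.2‖ *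
          ((temperWeight N (p.1 - p.2))⁻¹ * ‖g (p.1 - p.2)‖)) := by field_simp
    _ ≤ 2 ^ N * temperWeight N p.1 * temperWeight N p.2 * (‖φ p.1‖ * ‖ψ p.2‖ *
          ((temperWeight N (p.1 - p.2))⁻¹ * ‖g (p.1 - p.2)‖)) := by
        gcongr
        exact temperWeight_sub_le N p.1 p.2
    _ = _ := by ring

theorem continuous_integral_comp_sub_mul [μ.IsNegInvariant] (hg : IsTempered g μ) (ψ : 𝓢(E, ℂ)) :
    Continuous fun t => ∫ x, g (t - x) * ψ x ∂μ := by
  obtain ⟨N, hN⟩ := id hg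
  have hswap (t : E) : ∫ x, g (t - x) * ψ x ∂μ = ∫ y, g y * ψ (t - y) ∂μ := by
    rw [← integral_sub_left_eq_self _ μ t]
    simp
  simp_rw [hswap]
  refine continuous_iff_continuousAt.2 fun t₀ => ?_
  obtain ⟨C, hC⟩ : ∃ C, ∀ x, ‖temperWeightMul N ψ x‖ ≤ C :=
    ⟨_, SchwartzMap.norm_le_seminorm ℝ _⟩
  have hnear : ∀ᶠ t in 𝓝 t₀, temperWeight N t < temperWeight N t₀ + 1 :=
    (continuous_temperWeight N).continuousAt.eventually_lt_const (lt_add_one _)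
  refine continuousAt_of_dominated (bound := fun y => 2 ^ N * (temperWeight N t₀ + 1) * C *
    ‖(temperWeight N y)⁻¹ • g y‖) (.of_forall fun t => ?_) ?_ (hN.norm.const_mul _)
    (ae_of_all _ fun y => by fun_prop)
  · exact hg.aestronglyMeasurable.mul (by fun_prop : Continuous _).aestronglyMeasurable
  · filter_upwards [hnear] with t ht
    refine ae_of_all _ fun y => ?_
    have hy := temperWeight_pos N y
    have hpeetre := temperWeight_sub_le N t (t - y)
    rw [sub_sub_cancel] at hpeetre
    rw [norm_mul, norm_smul, Real.norm_of_nonneg (by positivity)]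
    calc ‖g y‖ * ‖ψ (t - y)‖
        = temperWeight N y * ‖ψ (t - y)‖ * ((temperWeight N y)⁻¹ * ‖g y‖) := by field_simp
      _ ≤ 2 ^ N * temperWeight N t * temperWeight N (t - y) * ‖ψ (t - y)‖ *
            ((temperWeight N y)⁻¹ * ‖g y‖) := by gcongr
      _ = 2 ^ N * temperWeight N t * ‖temperWeightMul N ψ (t - y)‖ *
            ((temperWeight N y)⁻¹ * ‖g y‖) := by rw [norm_temperWeightMul]; ring
      _ ≤ _ := by
        have := temperWeight_pos N t₀
        gcongr
        exact hC _

end Haar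

end Schwartz

end IsTempered

theorem isTempered_abs_rpow {p : ℝ} (hp : -1 < p) :
    IsTempered fun x : ℝ => ((|x| ^ p : ℝ) : ℂ) := by
  obtain ⟨N, hN⟩ := exists_nat_gt (p + 1)
  have hmeas : Measurable fun x : ℝ => (temperWeight N x)⁻¹ • ((|x| ^ p : ℝ) : ℂ) := by fun_prop
  have hnorm {x : ℝ} (hx : 0 < x) :
      ‖(temperWeight N x)⁻¹ • ((|x| ^ p : ℝ) : ℂ)‖ = x ^ p / (1 + x ^ 2) ^ N := by
    rw [norm_smul, Complex.norm_of_nonneg (by positivity), abs_of_pos hx, norm_inv,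
      Real.norm_of_nonneg (temperWeight_pos N x).le, temperWeight, Real.norm_eq_abs, sq_abs,
      inv_mul_eq_div]
  have hpos : IntegrableOn (fun x : ℝ => (temperWeight N x)⁻¹ • ((|x| ^ p : ℝ) : ℂ))
      (Set.Ioi 0) := by
    rw [← Set.Ioc_union_Ioi_eq_Ioi zero_le_one]
    refine IntegrableOn.union ?_ ?_
    · refine (intervalIntegral.intervalIntegrable_rpow' hp).1.mono' hmeas.aestronglyMeasurable ?_
      refine ae_restrict_of_forall_mem measurableSet_Ioc fun x hx => ?_
      rw [hnorm hx.1]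
      exact div_le_self (Real.rpow_nonneg hx.1.le p) (one_le_pow₀ (by nlinarith [sq_nonneg x]))
    · refine (integrableOn_Ioi_rpow_of_lt (a := p - N) (by linarith) one_pos).mono'
        hmeas.aestronglyMeasurable (ae_restrict_of_forall_mem measurableSet_Ioi fun x hx => ?_)
      have hx1 : 1 < x := hx
      rw [hnorm (by linarith), Real.rpow_sub (by linarith), Real.rpow_natCast]
      gcongr
      nlinarith
  refine ⟨N, integrable_of_integrableOn_Ioi hpos ?_⟩
  simpa only [temperWeight_neg, abs_neg] using hpos

theorem isTempered_of_norm_le_abs_rpow {f : ℝ → ℂ} {p C : ℝ} (hp : -1 < p)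
    (hf : AEStronglyMeasurable f) (hfp : ∀ᵐ x, ‖f x‖ ≤ C * |x| ^ p) : IsTempered f := by
  refine ((isTempered_abs_rpow hp).const_mul C).mono hf (hfp.mono fun x hx => hx.trans ?_)
  rw [norm_mul, Complex.norm_of_nonneg (r := |x| ^ p) (by positivity), Complex.norm_real]
  gcongr
  exact le_abs_self C

/-- The Fourier transform in the angular frequency, as an operator on Schwartz functions. -/
def angFourierCLM : 𝓢(ℝ, ℂ) →L[ℂ] 𝓢(ℝ, ℂ) :=
  SchwartzMap.compCLMOfContinuousLinearEquiv ℂ (ContinuousLinearEquiv.unitsEquivAut ℝ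
    (Units.mk0 (2 * Real.pi)⁻¹ (by positivity))) ∘L FourierTransform.fourierCLM ℂ 𝓢(ℝ, ℂ)

theorem angFourierCLM_eq_fourier (φ : 𝓢(ℝ, ℂ)) (ω : ℝ) :
    angFourierCLM φ ω = FourierTransform.fourier (φ : ℝ → ℂ) ((2 * Real.pi)⁻¹ * ω) := by
  rw [mul_comm]; rfl

@[simp]
theorem coe_angFourierCLM (φ : 𝓢(ℝ, ℂ)) : ⇑(angFourierCLM φ) = angFourier φ := by
  funext ω
  rw [angFourierCLM_eq_fourier, Real.fourier_real_eq_integral_exp_smul, angFourier]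
  refine integral_congr_ae (ae_of_all _ fun x => ?_)
  have hpi : (Real.pi : ℂ) ≠ 0 := by exact_mod_cast Real.pi_ne_zero
  simp only [smul_eq_mul]
  rw [mul_comm]
  congr 2
  push_cast
  field_simp

theorem invAngFourier_eq_angFourier_neg (ψ : ℝ → ℂ) (ω : ℝ) :
    invAngFourier ψ ω = 1 / (2 * Real.pi) * angFourier ψ (-ω) := by
  simp only [invAngFourier, angFourier, Complex.ofReal_neg, mul_neg, neg_mul, neg_neg,
    mul_right_comm Complex.I]

/-- The inverse Fourier transform in the angular frequency, as an operator on Schwartz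
functions. -/
def invAngFourierCLM : 𝓢(ℝ, ℂ) →L[ℂ] 𝓢(ℝ, ℂ) :=
  (1 / (2 * Real.pi) : ℂ) • (SchwartzMap.compCLMOfContinuousLinearEquiv ℂ
    (ContinuousLinearEquiv.neg ℝ) ∘L angFourierCLM)

@[simp]
theorem coe_invAngFourierCLM (ψ : 𝓢(ℝ, ℂ)) : ⇑(invAngFourierCLM ψ) = invAngFourier ψ := by
  funext ω
  rw [invAngFourier_eq_angFourier_neg, ← coe_angFourierCLM]
  rfl

theorem IsTempered.exists_isInvFourier {g : ℝ → ℂ} (hg : IsTempered g) :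
    ∃ U : 𝓢'(ℝ, ℂ), IsInvFourier g U := by
  obtain ⟨V, hV⟩ := hg.exists_distribution
  refine ⟨PointwiseConvergenceCLM.precomp _ invAngFourierCLM V, fun ψ => ?_⟩
  rw [← coe_invAngFourierCLM]
  exact ⟨hg.integrable_mul _, hV _⟩

theorem IsTempered.exists_agreesOn_univ {g : ℝ → ℂ} (hg : IsTempered g) :
    ∃ U : 𝓢'(ℝ, ℂ), AgreesOn U g Set.univ := by
  obtain ⟨U, hU⟩ := hg.exists_distribution
  exact ⟨U, fun ψ _ => ⟨hg.integrable_mul ψ, hU ψ⟩⟩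

section AbelPow

variable (a b p : ℂ)

/-- The combination `a (ε + iy)^p + b (ε - iy)^p`, whose limit at `ε = 0` is a homogeneous function
of degree `p` away from `y = 0`. -/
def abelPow (ε y : ℝ) : ℂ := a * (ε + Complex.I * y) ^ p + b * (ε - Complex.I * y) ^ p

@[fun_prop]
theorem measurable_abelPow : Measurable fun q : ℝ × ℝ => abelPow a b p q.1 q.2 := by
  unfold abelPow; fun_prop

theorem abelPow_neg (ε y : ℝ) : abelPow a b p ε (-y) = abelPow b a p ε y := by
  simp [abelPow, sub_eq_add_neg, add_comm]

theorem continuousAt_abelPow (ε : ℝ) {y : ℝ} (hy : y ≠ 0) :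
    ContinuousAt (fun q : ℝ × ℝ => abelPow a b p q.1 q.2) (ε, y) := by
  refine ContinuousAt.add (continuousAt_const.mul (ContinuousAt.cpow (by fun_prop)
    continuousAt_const (.inr ?_))) (continuousAt_const.mul (ContinuousAt.cpow (by fun_prop)
    continuousAt_const (.inr ?_))) <;> simpa

theorem norm_cpow_le_of_le_of_le_one_add {z : ℂ} {r : ℝ} (hr : 0 < r) (hz : r ≤ ‖z‖)
    (hz' : ‖z‖ ≤ 1 + r) :
    ‖z ^ p‖ ≤ Real.exp (Real.pi * |p.im|) * 2 ^ |p.re| * (1 + r ^ p.re) := by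
  have hnorm : ‖z‖ ^ p.re ≤ 2 ^ |p.re| * (1 + r ^ p.re) := by
    have hr' := Real.rpow_nonneg hr.le p.re
    rcases le_or_gt 0 p.re with hp | hp
    · have hmax : ‖z‖ ≤ 2 * max 1 r := by linarith [le_max_left 1 r, le_max_right 1 r]
      calc ‖z‖ ^ p.re ≤ (2 * max 1 r) ^ p.re := by gcongr
        _ = 2 ^ |p.re| * max 1 r ^ p.re := by
          rw [Real.mul_rpow two_pos.le (by positivity), abs_of_nonneg hp]
        _ ≤ 2 ^ |p.re| * (1 + r ^ p.re) := by
          gcongr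
          rcases max_choice 1 r with h | h <;> rw [h]
          · simpa using hr'
          · simp
    · calc ‖z‖ ^ p.re ≤ r ^ p.re := Real.rpow_le_rpow_of_nonpos hr hz hp.le
        _ ≤ 1 * (1 + r ^ p.re) := by linarith
        _ ≤ 2 ^ |p.re| * (1 + r ^ p.re) := by
          gcongr
          exact Real.one_le_rpow one_le_two (abs_nonneg _)
  have harg : -(z.arg * p.im) ≤ Real.pi * |p.im| := by
    calc -(z.arg * p.im) ≤ |z.arg| * |p.im| := by rw [← abs_mul]; exact neg_le_abs _
      _ ≤ Real.pi * |p.im| := by gcongr; exact Complex.abs_arg_le_pi z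
  rw [Complex.norm_cpow_of_ne_zero (norm_pos_iff.1 (hr.trans_le hz)), div_eq_mul_inv,
    ← Real.exp_neg, mul_comm, mul_assoc]
  gcongr

theorem exists_norm_abelPow_le : ∃ C, ∀ ε ∈ Set.Icc (0 : ℝ) 1, ∀ y ≠ 0,
    ‖abelPow a b p ε y‖ ≤ C * (1 + |y| ^ p.re) := by
  refine ⟨(‖a‖ + ‖b‖) * (Real.exp (Real.pi * |p.im|) * 2 ^ |p.re|), fun ε hε y hy => ?_⟩
  have hpow (c : ℂ) (hre : c.re = ε) (him : |c.im| = |y|) :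
      ‖c ^ p‖ ≤ Real.exp (Real.pi * |p.im|) * 2 ^ |p.re| * (1 + |y| ^ p.re) := by
    refine norm_cpow_le_of_le_of_le_one_add p (abs_pos.2 hy) (him ▸ Complex.abs_im_le_norm c) ?_
    refine (Complex.norm_le_abs_re_add_abs_im c).trans ?_
    rw [hre, him, abs_of_nonneg hε.1]
    linarith [hε.2]
  calc ‖abelPow a b p ε y‖
      ≤ ‖a‖ * ‖(ε + Complex.I * y : ℂ) ^ p‖ + ‖b‖ * ‖(ε - Complex.I * y : ℂ) ^ p‖ := by
        rw [← norm_mul, ← norm_mul]; exact norm_add_le _ _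
    _ ≤ (‖a‖ + ‖b‖) * (Real.exp (Real.pi * |p.im|) * 2 ^ |p.re| * (1 + |y| ^ p.re)) := by
        rw [add_mul]
        gcongr
        · exact hpow (ε + Complex.I * y) (by simp) (by simp)
        · exact hpow (ε - Complex.I * y) (by simp) (by simp)
    _ = _ := by ring

variable {p}

theorem isTempered_abelPow (hp : -1 < p.re) {ε : ℝ} (hε : ε ∈ Set.Icc 0 1) :
    IsTempered fun y => abelPow a b p ε y := by
  obtain ⟨C, hC⟩ := exists_norm_abelPow_le a b p
  refine (((isTempered_abs_rpow (by norm_num : (-1 : ℝ) < 0)).add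
    (isTempered_abs_rpow hp)).const_mul C).mono
    (by fun_prop : Measurable _).aestronglyMeasurable ?_
  filter_upwards [Measure.ae_ne volume 0] with y hy
  refine (hC ε hε y hy).trans ((le_abs_self _).trans_eq ?_)
  rw [Real.rpow_zero, ← Complex.ofReal_add, ← Complex.ofReal_mul, Complex.norm_real,
    Real.norm_eq_abs]

variable {φ : 𝓢(ℝ, ℂ)} {x : ℝ}

theorem integrable_abs_sub_rpow_mul {r : ℝ} (h : x ∉ tsupport φ ∨ -1 < r) :
    Integrable fun τ => ((|τ - x| ^ r : ℝ) : ℂ) * φ τ := by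
  by_cases hr : -1 < r
  · exact ((isTempered_abs_rpow hr).comp_sub_right x).integrable_mul φ
  obtain ⟨δ, hδ, hball⟩ := Metric.isOpen_iff.1 (isClosed_tsupport φ).isOpen_compl x
    (h.resolve_right hr)
  have hmeas : Measurable fun τ => ((|τ - x| ^ r : ℝ) : ℂ) := by fun_prop
  refine (φ.integrable.norm.const_mul (δ ^ r)).mono' (hmeas.aestronglyMeasurable.mul
    φ.continuous.aestronglyMeasurable) (ae_of_all _ fun τ => ?_)
  rw [norm_mul, Complex.norm_of_nonneg (r := |τ - x| ^ r) (by positivity)]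
  rcases lt_or_ge |τ - x| δ with hτ | hτ
  · rw [image_eq_zero_of_notMem_tsupport (hball (mem_ball_iff_norm.2 hτ)), norm_zero, mul_zero,
      mul_zero]
  · exact mul_le_mul_of_nonneg_right (Real.rpow_le_rpow_of_nonpos hδ hτ (by linarith))
      (norm_nonneg _)

theorem exists_integrable_bound_abelPow_sub_mul (h : x ∉ tsupport φ ∨ -1 < p.re) :
    ∃ G : ℝ → ℝ, Integrable G ∧ ∀ ε ∈ Set.Icc (0 : ℝ) 1, ∀ τ ≠ x,
      ‖abelPow a b p ε (τ - x) * φ τ‖ ≤ G τ := by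
  obtain ⟨C, hC⟩ := exists_norm_abelPow_le a b p
  refine ⟨_, (φ.integrable.norm.add (integrable_abs_sub_rpow_mul h).norm).const_mul C,
    fun ε hε τ hτ => ?_⟩
  rw [Pi.add_apply, norm_mul, norm_mul _ (φ τ),
    Complex.norm_of_nonneg (r := |τ - x| ^ p.re) (by positivity), ← one_add_mul, ← mul_assoc]
  gcongr
  exact hC ε hε _ (sub_ne_zero.2 hτ)

theorem integrable_abelPow_sub_mul (h : x ∉ tsupport φ ∨ -1 < p.re) {ε : ℝ}
    (hε : ε ∈ Set.Icc 0 1) : Integrable fun τ => abelPow a b p ε (τ - x) * φ τ := by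
  obtain ⟨G, hG, hbound⟩ := exists_integrable_bound_abelPow_sub_mul a b h
  have hmeas : Measurable fun τ => abelPow a b p ε (τ - x) := by fun_prop
  exact hG.mono' (hmeas.aestronglyMeasurable.mul φ.continuous.aestronglyMeasurable)
    ((Measure.ae_ne volume x).mono (hbound ε hε))

theorem tendsto_integral_abelPow_sub_mul (h : x ∉ tsupport φ ∨ -1 < p.re) :
    Tendsto (fun ε => ∫ τ, abelPow a b p ε (τ - x) * φ τ) (𝓝[>] 0)
      (𝓝 (∫ τ, abelPow a b p 0 (τ - x) * φ τ)) := by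
  obtain ⟨G, hG, hbound⟩ := exists_integrable_bound_abelPow_sub_mul a b h
  have hIcc : ∀ᶠ ε : ℝ in 𝓝[>] 0, ε ∈ Set.Icc 0 1 := Icc_mem_nhdsGT one_pos
  refine tendsto_integral_filter_of_dominated_convergence G ?_ ?_ hG ?_
  · exact hIcc.mono fun ε hε => (integrable_abelPow_sub_mul a b h hε).1
  · exact hIcc.mono fun ε hε => (Measure.ae_ne volume x).mono (hbound ε hε)
  · filter_upwards [Measure.ae_ne volume x] with τ hτ
    have hcont := continuousAt_abelPow a b p 0 (sub_ne_zero.2 hτ)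
    exact ((hcont.comp (f := fun ε => (ε, τ - x)) (by fun_prop)).tendsto.mono_left
      nhdsWithin_le_nhds).mul_const (φ τ)

end AbelPow

section RemKernel

variable (a b s : ℂ) (k : ℕ)

/-- The coefficient of `x^j` in the Taylor correction of `remKernel`. -/
def remKernelCoeff (ε τ : ℝ) (j : ℕ) : ℂ :=
  genBinom (j + s) j *
    abelPow (a * Complex.I ^ j) (b * (-Complex.I) ^ j) (-s - 1 - j) ε τ

theorem remKernel_eq_abelPow (ε x τ : ℝ) :
    remKernel a b s k ε x τ = Complex.Gamma (s + 1) / (2 * Real.pi) *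
      (abelPow a b (-s - 1) ε (τ - x) -
        ∑ j ∈ Finset.range k, remKernelCoeff a b s ε τ j * x ^ j) := by
  have hsum : ∑ j ∈ Finset.range k, remKernelCoeff a b s ε τ j * x ^ j =
      a * (∑ j ∈ Finset.range k, genBinom (j + s) j * (Complex.I * x) ^ j *
        (ε + Complex.I * τ) ^ (-s - 1 - j)) +
      b * ∑ j ∈ Finset.range k, genBinom (j + s) j * (Complex.I * (-x)) ^ j *
        (ε - Complex.I * τ) ^ (-s - 1 - j) := by
    rw [Finset.mul_sum, Finset.mul_sum, ← Finset.sum_add_distrib]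
    refine Finset.sum_congr rfl fun j _ => ?_
    rw [remKernelCoeff, abelPow, mul_neg, ← neg_mul, mul_pow, mul_pow]
    ring
  rw [hsum, remKernel, laplaceExpRem, laplaceExpRem, abelPow]
  push_cast
  ring_nf

@[fun_prop]
theorem measurable_remKernelCoeff (j : ℕ) :
    Measurable fun q : ℝ × ℝ => remKernelCoeff a b s q.1 q.2 j := by
  unfold remKernelCoeff; fun_prop

theorem continuousAt_remKernelCoeff (ε : ℝ) {τ : ℝ} (hτ : τ ≠ 0) (j : ℕ) :
    ContinuousAt (fun t => remKernelCoeff a b s ε t j) τ :=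
  ((continuousAt_abelPow _ _ _ ε hτ).comp (f := fun t => (ε, t)) (by fun_prop)).const_mul _

@[fun_prop]
theorem measurable_remKernel :
    Measurable fun q : ℝ × ℝ × ℝ => remKernel a b s k q.1 q.2.1 q.2.2 := by
  simp only [remKernel_eq_abelPow]; fun_prop

section Source

variable {s k} {φ : 𝓢(ℝ, ℂ)} {x ε : ℝ}

theorem integrable_remKernelCoeff_mul (h : 0 ∉ tsupport φ) (hε : ε ∈ Set.Icc 0 1) (j : ℕ) :
    Integrable fun τ => remKernelCoeff a b s ε τ j * φ τ := by
  simpa only [remKernelCoeff, sub_zero, mul_assoc] using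
    (integrable_abelPow_sub_mul (a * Complex.I ^ j) (b * (-Complex.I) ^ j)
      (p := -s - 1 - j) (.inl h) hε).const_mul (genBinom (j + s) j)

theorem tendsto_integral_remKernelCoeff_mul (h : 0 ∉ tsupport φ) (j : ℕ) :
    Tendsto (fun ε => ∫ τ, remKernelCoeff a b s ε τ j * φ τ) (𝓝[>] 0)
      (𝓝 (∫ τ, remKernelCoeff a b s 0 τ j * φ τ)) := by
  simpa only [remKernelCoeff, sub_zero, mul_assoc, integral_const_mul] using
    (tendsto_integral_abelPow_sub_mul (a * Complex.I ^ j) (b * (-Complex.I) ^ j)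
      (p := -s - 1 - j) (.inl h)).const_mul (genBinom (j + s) j)

variable (hx : x ∉ tsupport φ ∨ s.re < 0) (h0 : 0 ∉ tsupport φ ∨ k = 0)

include hx in
theorem integrable_abelPow_remKernel_mul (hε : ε ∈ Set.Icc 0 1) :
    Integrable fun τ => abelPow a b (-s - 1) ε (τ - x) * φ τ :=
  integrable_abelPow_sub_mul a b (hx.imp_right fun h => by simpa) hε

include h0 in
theorem integrable_sum_remKernelCoeff_mul (hε : ε ∈ Set.Icc 0 1) :
    ∀ j ∈ Finset.range k, Integrable fun τ => remKernelCoeff a b s ε τ j * φ τ * x ^ j :=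
  fun j hj => (integrable_remKernelCoeff_mul a b
    (h0.resolve_right (Nat.ne_zero_of_lt (Finset.mem_range.1 hj))) hε j).mul_const _

theorem remKernel_mul_eq (z : ℂ) (τ : ℝ) :
    remKernel a b s k ε x τ * z = Complex.Gamma (s + 1) / (2 * Real.pi) *
      (abelPow a b (-s - 1) ε (τ - x) * z -
        ∑ j ∈ Finset.range k, remKernelCoeff a b s ε τ j * z * x ^ j) := by
  rw [remKernel_eq_abelPow, mul_assoc, sub_mul, Finset.sum_mul]
  simp only [mul_right_comm _ _ z]

include hx h0 in
theorem integrable_remKernel_mul (hε : ε ∈ Set.Icc 0 1) :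
    Integrable fun τ => remKernel a b s k ε x τ * φ τ := by
  simp only [remKernel_mul_eq]
  exact ((integrable_abelPow_remKernel_mul a b hx hε).sub
    (integrable_finsetSum _ (integrable_sum_remKernelCoeff_mul a b h0 hε))).const_mul _

include hx h0 in
theorem integral_remKernel_mul (hε : ε ∈ Set.Icc 0 1) :
    ∫ τ, remKernel a b s k ε x τ * φ τ = Complex.Gamma (s + 1) / (2 * Real.pi) *
      ((∫ τ, abelPow a b (-s - 1) ε (τ - x) * φ τ) -
        ∑ j ∈ Finset.range k, (∫ τ, remKernelCoeff a b s ε τ j * φ τ) * x ^ j) := by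
  have hsum := integrable_sum_remKernelCoeff_mul (s := s) (x := x) a b h0 hε
  simp only [remKernel_mul_eq]
  rw [integral_const_mul, integral_sub (integrable_abelPow_remKernel_mul a b hx hε)
    (integrable_finsetSum _ hsum), integral_finsetSum _ hsum]
  simp only [integral_mul_const]

include hx h0 in
theorem tendsto_integral_remKernel_mul :
    Tendsto (fun ε => ∫ τ, remKernel a b s k ε x τ * φ τ) (𝓝[>] 0)
      (𝓝 (∫ τ, remKernel a b s k 0 x τ * φ τ)) := by
  have hIcc : ∀ᶠ ε : ℝ in 𝓝[>] 0, ε ∈ Set.Icc 0 1 := Icc_mem_nhdsGT one_pos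
  rw [integral_remKernel_mul a b hx h0 (by simp),
    tendsto_congr' (hIcc.mono fun ε hε => integral_remKernel_mul a b hx h0 hε)]
  refine ((tendsto_integral_abelPow_sub_mul a b (hx.imp_right fun h => by simpa)).sub
    (tendsto_finsetSum _ fun j hj => ?_)).const_mul _
  exact (tendsto_integral_remKernelCoeff_mul a b
    (h0.resolve_right (Nat.ne_zero_of_lt (Finset.mem_range.1 hj))) j).mul_const _

end Source

section Target

theorem isTempered_pow (j : ℕ) : IsTempered fun x : ℝ => (x : ℂ) ^ j :=
  isTempered_of_norm_le_abs_rpow (p := j) (C := 1) (by linarith [j.cast_nonneg (α := ℝ)])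
    (by fun_prop) (ae_of_all _ fun x => by simp)

variable {s} (hs : s.re < 0)

include hs in
theorem isTempered_abelPow_remKernel : IsTempered fun y => abelPow a b (-s - 1) 0 y :=
  isTempered_abelPow a b (by simpa) (by simp)

include hs in
theorem isTempered_remKernel (τ : ℝ) : IsTempered fun x => remKernel a b s k 0 x τ := by
  simp only [remKernel_eq_abelPow, sub_eq_add_neg (abelPow _ _ _ _ _), ← Finset.sum_neg_distrib,
    ← neg_mul (remKernelCoeff _ _ _ _ _ _)]
  refine (IsTempered.add ?_ (.sum fun j _ => (isTempered_pow j).const_mul _)).const_mul _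
  simpa only [← abelPow_neg b a, neg_sub] using
    (isTempered_abelPow_remKernel b a hs).comp_sub_right τ

variable (ψ : 𝓢(ℝ, ℂ))

include hs in
theorem integral_remKernel_mul_right (τ : ℝ) :
    ∫ x, remKernel a b s k 0 x τ * ψ x = Complex.Gamma (s + 1) / (2 * Real.pi) *
      ((∫ x, abelPow a b (-s - 1) 0 (τ - x) * ψ x) -
        ∑ j ∈ Finset.range k, remKernelCoeff a b s 0 τ j * ∫ x : ℝ, (x : ℂ) ^ j * ψ x) := by
  have habel : Integrable fun x => abelPow a b (-s - 1) 0 (τ - x) * ψ x := by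
    simpa only [← abelPow_neg b a, neg_sub] using
      ((isTempered_abelPow_remKernel b a hs).comp_sub_right τ).integrable_mul ψ
  have hsum : ∀ j ∈ Finset.range k, Integrable fun x : ℝ =>
      remKernelCoeff a b s 0 τ j * ((x : ℂ) ^ j * ψ x) := fun j _ =>
    ((isTempered_pow j).integrable_mul ψ).const_mul _
  simp only [remKernel_mul_eq, mul_assoc (remKernelCoeff _ _ _ _ _ _), mul_comm (ψ _) (_ ^ _)]
  rw [integral_const_mul, integral_sub habel (integrable_finsetSum _ hsum),
    integral_finsetSum _ hsum]
  simp only [integral_const_mul]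

include hs in
theorem continuousAt_integral_remKernel_mul {τ : ℝ} (hτ : τ ≠ 0) :
    ContinuousAt (fun t => ∫ x, remKernel a b s k 0 x t * ψ x) τ := by
  simp only [integral_remKernel_mul_right a b k hs]
  refine .mul continuousAt_const (.sub ?_ (tendsto_finsetSum _ fun j _ => ?_))
  · exact ((isTempered_abelPow_remKernel a b hs).continuous_integral_comp_sub_mul ψ).continuousAt
  · exact (continuousAt_remKernelCoeff a b s 0 hτ j).mul continuousAt_const

include hs in
theorem integrable_prod_remKernel_mul {φ : 𝓢(ℝ, ℂ)} (h0 : 0 ∉ tsupport φ) :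
    Integrable fun q : ℝ × ℝ => remKernel a b s k 0 q.2 q.1 * (φ q.1 * ψ q.2) := by
  have hsum : ∀ j ∈ Finset.range k, Integrable fun q : ℝ × ℝ =>
      remKernelCoeff a b s 0 q.1 j * (φ q.1 * ψ q.2) * q.2 ^ j := fun j _ =>
    ((integrable_remKernelCoeff_mul a b h0 (ε := 0) (by simp) j).mul_prod
      ((isTempered_pow j).integrable_mul ψ)).congr (ae_of_all _ fun q => by ring)
  simp only [remKernel_mul_eq]
  exact (((isTempered_abelPow_remKernel a b hs).integrable_comp_sub_mul_mul φ ψ).sub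
    (integrable_finsetSum _ hsum)).const_mul _

end Target

end RemKernel

theorem integral_mul_angFourier {F φ : ℝ → ℂ} (hF : Integrable F) (hφ : Integrable φ) :
    ∫ ω, F ω * angFourier φ ω = ∫ τ, (∫ ω, F ω * fourierDirac τ ω) * φ τ := by
  have hint : Integrable (fun p : ℝ × ℝ => F p.1 * φ p.2 * fourierDirac p.2 p.1)
      (volume.prod volume) :=
    (hF.mul_prod hφ).mul_bdd (c := 1) (by fun_prop) (ae_of_all _ fun _ =>
      (norm_fourierDirac _ _).le)
  simp only [angFourier, ← integral_const_mul, ← integral_mul_const]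
  refine Eq.trans (integral_congr_ae (ae_of_all _ fun ω => ?_))
    ((integral_integral_swap (f := fun ω τ => F ω * φ τ * fourierDirac τ ω) hint).trans
      (integral_congr_ae (ae_of_all _ fun τ => ?_)))
  · exact integral_congr_ae (ae_of_all _ fun τ => (mul_assoc _ _ _).symm)
  · exact integral_congr_ae (ae_of_all _ fun ω => mul_right_comm _ _ _)

theorem integrable_abs_pow_mul_norm (k : ℕ) (φ : 𝓢(ℝ, ℂ)) :
    Integrable fun x : ℝ => |x| ^ k * ‖φ x‖ := by
  simpa using φ.integrable_pow_mul volume k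

section RemOp

variable (a b s : ℂ) (k : ℕ)

/-- The operator `φ ↦ 1/(2π) ∫ φ̂(ω) h(ω) (e^{iωx} - ∑_{j<k} (iωx)^j / j!) dω` with the Abel
damping `e^{-|εω|}`. At `ε = 0` it is the derivative for `k = 0`, and the integrator of order `-s`
in general. -/
def remOp (ε : ℝ) (φ : 𝓢(ℝ, ℂ)) (x : ℝ) : ℂ :=
  1 / (2 * Real.pi) * ∫ ω, dampedSymbol a b s k ε x ω * angFourier φ ω

theorem fracD_eq_remOp (γ : ℂ) (φ : 𝓢(ℝ, ℂ)) (x : ℝ) :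
    fracD a b γ φ x = remOp a b γ 0 0 φ x := by
  simp only [fracD, remOp, dampedSymbol_zero, remSymbol, expRem_zero, mul_comm (angFourier φ _),
    mul_right_comm _ (angFourier φ _), mul_right_comm Complex.I (x : ℂ)]

theorem fracI_eq_remOp (γ : ℂ) (φ : 𝓢(ℝ, ℂ)) (x : ℝ) :
    fracI a b γ k φ x = remOp a⁻¹ b⁻¹ (-γ) k 0 φ x := by
  simp only [fracI, remOp, dampedSymbol_zero, remSymbol, ← inv_homMult, expRem,
    mul_comm (angFourier φ _), div_eq_inv_mul _ (homMult _ _ _ _),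
    mul_right_comm Complex.I (x : ℂ), mul_pow, mul_div_right_comm]
  simp only [mul_right_comm _ ((x : ℂ) ^ _)]

section Integrable

variable {s k} (hk : -1 < s.re + k) (φ : 𝓢(ℝ, ℂ))

include hk in
theorem integrable_abs_rpow_mul_angFourier :
    Integrable fun ω : ℝ => |ω| ^ (s.re + k) * ‖angFourier φ ω‖ := by
  refine ((isTempered_abs_rpow hk).integrable_mul (angFourierCLM φ)).norm.congr
    (ae_of_all _ fun ω => ?_)
  simp only [coe_angFourierCLM, norm_mul,
    Complex.norm_of_nonneg (Real.rpow_nonneg (abs_nonneg ω) _)]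

theorem norm_dampedSymbol_mul_angFourier_le (ε x ω : ℝ) :
    ‖dampedSymbol a b s k ε x ω * angFourier φ ω‖ ≤
      (‖a‖ + ‖b‖) * |x| ^ k * (|ω| ^ (s.re + k) * ‖angFourier φ ω‖) := by
  rw [norm_mul, ← mul_assoc]
  gcongr
  exact norm_dampedSymbol_le a b s k ε x ω

@[fun_prop]
theorem measurable_angFourier : Measurable (angFourier φ) := by
  rw [← coe_angFourierCLM]
  exact (angFourierCLM φ).continuous.measurable

include hk in
theorem exists_norm_remOp_le : ∃ C, ∀ ε x, ‖remOp a b s k ε φ x‖ ≤ C * |x| ^ k := by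
  refine ⟨1 / (2 * Real.pi) * ((‖a‖ + ‖b‖) * ∫ ω : ℝ, |ω| ^ (s.re + k) * ‖angFourier φ ω‖),
    fun ε x => ?_⟩
  rw [remOp, norm_mul]
  calc _ ≤ 1 / (2 * Real.pi) * ∫ ω : ℝ, (‖a‖ + ‖b‖) * |x| ^ k *
        (|ω| ^ (s.re + k) * ‖angFourier φ ω‖) := by
        gcongr
        · simp [abs_of_pos Real.pi_pos]
        · exact norm_integral_le_of_norm_le ((integrable_abs_rpow_mul_angFourier hk φ).const_mul _)
            (ae_of_all _ (norm_dampedSymbol_mul_angFourier_le a b φ ε x))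
    _ = _ := by rw [integral_const_mul]; ring

include hk in
theorem continuous_remOp : Continuous fun q : ℝ × ℝ => remOp a b s k q.1 φ q.2 := by
  refine continuous_const.mul (continuous_iff_continuousAt.2 fun q₀ => ?_)
  have hnear : ∀ᶠ q : ℝ × ℝ in 𝓝 q₀, |q.2| < |q₀.2| + 1 :=
    continuous_snd.abs.continuousAt.eventually_lt_const (lt_add_one _)
  refine continuousAt_of_dominated (bound := fun ω => (‖a‖ + ‖b‖) * (|q₀.2| + 1) ^ k *
    (|ω| ^ (s.re + k) * ‖angFourier φ ω‖))
    (.of_forall fun q => (by fun_prop : Measurable _).aestronglyMeasurable) ?_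
    ((integrable_abs_rpow_mul_angFourier hk φ).const_mul _) (ae_of_all _ fun ω => ?_)
  · filter_upwards [hnear] with q hq
    refine ae_of_all _ fun ω => (norm_dampedSymbol_mul_angFourier_le a b φ _ _ ω).trans ?_
    gcongr
  · unfold dampedSymbol remSymbol
    fun_prop

include hk in
theorem tendsto_remOp (x : ℝ) :
    Tendsto (fun ε => remOp a b s k ε φ x) (𝓝[>] 0) (𝓝 (remOp a b s k 0 φ x)) :=
  (((continuous_remOp a b hk φ).comp (f := fun ε : ℝ => (ε, x)) (by fun_prop)).tendsto
    0).mono_left nhdsWithin_le_nhds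

variable (hs : ∀ n : ℕ, s + 1 ≠ -n)

include hk hs in
theorem remOp_eq_integral_remKernel {ε : ℝ} (hε : 0 < ε) (x : ℝ) :
    remOp a b s k ε φ x = ∫ τ, remKernel a b s k ε x τ * φ τ := by
  have hsymbol : Integrable fun ω => dampedSymbol a b s k ε x ω := by
    simpa [fourierDirac] using integrable_dampedSymbol_mul_fourierDirac a b hk hε x 0
  simp only [remOp, ← integral_dampedSymbol_mul_fourierDirac a b hk hε _ _ hs, mul_assoc,
    integral_const_mul, integral_mul_angFourier hsymbol φ.integrable]

include hk hs in
theorem tendsto_integral_remKernel_mul_remOp (x : ℝ) :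
    Tendsto (fun ε => ∫ τ, remKernel a b s k ε x τ * φ τ) (𝓝[>] 0)
      (𝓝 (remOp a b s k 0 φ x)) := by
  refine (tendsto_remOp a b hk φ x).congr' ?_
  filter_upwards [self_mem_nhdsWithin] with ε hε
  exact remOp_eq_integral_remKernel a b hk φ hs hε x

include hk hs in
theorem remOp_zero_eq_integral_remKernel {φ : 𝓢(ℝ, ℂ)} {x : ℝ} (hx : x ∉ tsupport φ ∨ s.re < 0)
    (h0 : 0 ∉ tsupport φ ∨ k = 0) :
    remOp a b s k 0 φ x = ∫ τ, remKernel a b s k 0 x τ * φ τ :=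
  tendsto_nhds_unique (tendsto_integral_remKernel_mul_remOp a b hk φ hs x)
    (tendsto_integral_remKernel_mul a b hx h0)

include hk in
theorem integral_mul_remOp (ψ : 𝓢(ℝ, ℂ)) :
    ∫ x, φ x * remOp a b s k 0 ψ x =
      1 / (2 * Real.pi) * ∫ ω, (∫ x, φ x * remSymbol a b s k x ω) * angFourier ψ ω := by
  have hint : Integrable (fun q : ℝ × ℝ =>
      φ q.1 * (remSymbol a b s k q.1 q.2 * angFourier ψ q.2)) (volume.prod volume) := by
    refine (((integrable_abs_pow_mul_norm k φ).mul_prod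
      (integrable_abs_rpow_mul_angFourier hk ψ)).const_mul (‖a‖ + ‖b‖)).mono' ?_
        (ae_of_all _ fun q => ?_)
    · exact (φ.continuous.comp continuous_fst).aestronglyMeasurable.mul
        (by fun_prop : Measurable _).aestronglyMeasurable
    · rw [norm_mul, ← dampedSymbol_zero]
      calc _ ≤ ‖φ q.1‖ *
            ((‖a‖ + ‖b‖) * |q.1| ^ k * (|q.2| ^ (s.re + k) * ‖angFourier ψ q.2‖)) := by
            gcongr
            exact norm_dampedSymbol_mul_angFourier_le a b ψ _ _ _
        _ = _ := by ring
  simp only [remOp, dampedSymbol_zero, mul_left_comm (φ _), integral_const_mul]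
  simp only [← integral_const_mul (φ _), ← integral_mul_const]
  rw [integral_integral_swap hint]
  simp only [mul_assoc]

end Integrable

end RemOp

section AdjSymbol

variable (a b γ : ℂ) (k : ℕ)

theorem iteratedDeriv_fourierDirac (τ : ℝ) (j : ℕ) :
    iteratedDeriv j (fourierDirac τ) = fun ω => (-(Complex.I * τ)) ^ j * fourierDirac τ ω := by
  induction j with
  | zero => simp
  | succ j ih =>
    funext ω
    have hlinear : HasDerivAt (fun ω : ℝ => -(Complex.I * ω * τ)) (-(Complex.I * τ)) ω := by
      simpa using (((Complex.ofRealCLM.hasDerivAt (x := ω)).const_mul Complex.I).mul_const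
        (τ : ℂ)).fun_neg
    have hderiv : HasDerivAt (fourierDirac τ) (fourierDirac τ ω * -(Complex.I * τ)) ω :=
      hlinear.cexp
    rw [iteratedDeriv_succ, ih, (hderiv.const_mul _).deriv]
    ring

theorem iteratedDeriv_fourierDirac_zero (τ : ℝ) (j : ℕ) :
    iteratedDeriv j (fourierDirac τ) 0 = (-(Complex.I * τ)) ^ j := by
  simp [iteratedDeriv_fourierDirac, fourierDirac]

theorem adjSymbol_fourierDirac (τ ω : ℝ) :
    adjSymbol a b γ k (fourierDirac τ) ω = remSymbol a⁻¹ b⁻¹ (-γ) k τ (-ω) := by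
  rw [adjSymbol, remSymbol, ← inv_homMult, expRem, div_eq_inv_mul]
  simp only [iteratedDeriv_fourierDirac_zero, fourierDirac, Complex.ofReal_neg,
    div_mul_eq_mul_div, ← mul_pow, mul_neg, neg_mul, mul_right_comm Complex.I (ω : ℂ)]

variable (φ : 𝓢(ℝ, ℂ))

theorem iteratedDeriv_angFourier_zero (j : ℕ) :
    iteratedDeriv j (angFourier φ) 0 = ∫ τ, φ τ * (-(Complex.I * τ)) ^ j := by
  have hscale : angFourier φ =
      fun ω => FourierTransform.fourier (φ : ℝ → ℂ) ((2 * Real.pi)⁻¹ * ω) := by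
    rw [← coe_angFourierCLM]
    exact funext (angFourierCLM_eq_fourier φ)
  have hsmooth : ContDiff ℝ j (FourierTransform.fourier (φ : ℝ → ℂ)) := by
    rw [← SchwartzMap.fourier_coe]
    exact SchwartzMap.smooth _ _
  have hmoment (n : ℕ) (_ : (n : ℕ∞) ≤ ⊤) : Integrable fun x : ℝ => x ^ n • φ x := by
    simpa using (isTempered_pow n).integrable_mul φ
  have hpi : (Real.pi : ℂ) ≠ 0 := by exact_mod_cast Real.pi_ne_zero
  rw [hscale, iteratedDeriv_comp_const_smul hsmooth, Real.iteratedDeriv_fourier hmoment le_top]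
  beta_reduce
  rw [mul_zero, Real.fourier_real_eq_integral_exp_smul, ← integral_smul]
  refine integral_congr_ae (ae_of_all _ fun τ => ?_)
  simp only [mul_zero, Complex.ofReal_zero, zero_mul, Complex.exp_zero, one_mul, smul_eq_mul,
    Complex.real_smul]
  push_cast
  rw [← mul_assoc, ← mul_pow, mul_comm (φ τ)]
  congr 2
  field_simp

theorem adjSymbol_angFourier (ω : ℝ) :
    adjSymbol a b γ k (angFourier φ) ω = ∫ τ, φ τ * remSymbol a⁻¹ b⁻¹ (-γ) k τ (-ω) := by
  have hmoment (j : ℕ) : Integrable fun τ : ℝ => φ τ * (-(Complex.I * τ)) ^ j :=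
    (((isTempered_pow j).integrable_mul φ).const_mul ((-Complex.I) ^ j)).congr
      (ae_of_all _ fun τ => by simp only [← neg_mul, mul_pow]; ring)
  have hdirac : Integrable fun τ => φ τ * fourierDirac τ ω :=
    φ.integrable.mul_bdd (c := 1) (by fun_prop) (ae_of_all _ fun τ => (norm_fourierDirac _ _).le)
  have hsum : ∀ j ∈ Finset.range k, Integrable fun τ : ℝ =>
      φ τ * (-(Complex.I * τ)) ^ j / j.factorial * (ω : ℂ) ^ j := fun j _ =>
    ((hmoment j).div_const _).mul_const _
  calc adjSymbol a b γ k (angFourier φ) ω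
      = ((∫ τ, φ τ * fourierDirac τ ω) - ∑ j ∈ Finset.range k,
          ∫ τ : ℝ, φ τ * (-(Complex.I * τ)) ^ j / j.factorial * (ω : ℂ) ^ j) /
            homMult a b γ (-ω) := by
        simp only [integral_mul_const, integral_div, ← iteratedDeriv_angFourier_zero]
        rfl
    _ = ∫ τ, (φ τ * fourierDirac τ ω - ∑ j ∈ Finset.range k,
          φ τ * (-(Complex.I * τ)) ^ j / j.factorial * (ω : ℂ) ^ j) / homMult a b γ (-ω) := by
        rw [integral_div, integral_sub hdirac (integrable_finsetSum _ hsum),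
          integral_finsetSum _ hsum]
    _ = ∫ τ, φ τ * remSymbol a⁻¹ b⁻¹ (-γ) k τ (-ω) := by
        simp only [← adjSymbol_fourierDirac, adjSymbol, iteratedDeriv_fourierDirac_zero,
          mul_div_assoc, mul_assoc, ← Finset.mul_sum, ← mul_sub]

end AdjSymbol

theorem integral_mul_invAngFourier (g ψ : ℝ → ℂ) :
    ∫ ω, g ω * invAngFourier ψ ω = 1 / (2 * Real.pi) * ∫ ω, g (-ω) * angFourier ψ ω := by
  rw [← integral_neg_eq_self]
  simp only [invAngFourier_eq_angFourier_neg, neg_neg, mul_left_comm (g _), integral_const_mul]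

theorem fracIAdj_eq_integral_mul_remOp (a b : ℂ) {γ : ℂ} {k : ℕ} (hk : -1 < (-γ).re + k)
    (φ ψ : 𝓢(ℝ, ℂ)) :
    fracIAdj a b γ k φ ψ = ∫ τ, φ τ * remOp a⁻¹ b⁻¹ (-γ) k 0 ψ τ := by
  rw [fracIAdj, integral_mul_invAngFourier, integral_mul_remOp _ _ hk]
  simp only [adjSymbol_angFourier, neg_neg]

theorem integral_mul_remSymbol_zero (a b s : ℂ) (φ : ℝ → ℂ) (ω : ℝ) :
    ∫ x, φ x * remSymbol a b s 0 x ω = homMult a b s ω * angFourier φ (-ω) := by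
  simp only [remSymbol, expRem_zero, angFourier, mul_left_comm (φ _), integral_const_mul,
    Complex.ofReal_neg, mul_neg, neg_mul, neg_neg, mul_right_comm Complex.I]

theorem integral_mul_remOp_comm (a b : ℂ) {s : ℂ} (hs : -1 < s.re) (φ ψ : 𝓢(ℝ, ℂ)) :
    ∫ x, ψ x * remOp a b s 0 0 φ x = ∫ x, φ x * remOp b a s 0 0 ψ x := by
  have hk : -1 < s.re + (0 : ℕ) := by simpa
  rw [integral_mul_remOp _ _ hk, integral_mul_remOp _ _ hk, ← integral_neg_eq_self]
  simp only [integral_mul_remSymbol_zero, neg_neg, homMult_neg, mul_right_comm]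

theorem exists_isInvFourier_adjSymbol_angFourier (a b : ℂ) {γ : ℂ} {k : ℕ}
    (hk : -1 < (-γ).re + k) (φ : 𝓢(ℝ, ℂ)) :
    ∃ V : 𝓢'(ℝ, ℂ), IsInvFourier (adjSymbol a b γ k (angFourier φ)) V := by
  refine (isTempered_of_norm_le_abs_rpow hk (C := ∫ τ : ℝ, (‖a⁻¹‖ + ‖b⁻¹‖) * (|τ| ^ k * ‖φ τ‖))
    ?_ (ae_of_all _ fun ω => ?_)).exists_isInvFourier
  · unfold adjSymbol
    exact (by fun_prop : Measurable _).aestronglyMeasurable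
  · rw [adjSymbol_angFourier, ← integral_mul_const]
    refine norm_integral_le_of_norm_le (((integrable_abs_pow_mul_norm k φ).const_mul _).mul_const _)
      (ae_of_all _ fun τ => ?_)
    have hsymbol := norm_remSymbol_le a⁻¹ b⁻¹ (-γ) k τ (-ω)
    rw [abs_neg] at hsymbol
    rw [norm_mul]
    calc _ ≤ ‖φ τ‖ * ((‖a⁻¹‖ + ‖b⁻¹‖) * |τ| ^ k * |ω| ^ ((-γ).re + k)) := by gcongr
      _ = _ := by ring

namespace IsDeltaSequence

variable {τ : ℝ} {φ : ℕ → 𝓢(ℝ, ℂ)}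

theorem integral_norm (hφ : IsDeltaSequence τ φ) (n : ℕ) : ∫ t, ‖φ n t‖ = 1 := by
  have hnorm (t : ℝ) : ((‖φ n t‖ : ℝ) : ℂ) = φ n t := by
    obtain ⟨r, hr, h⟩ := hφ.1 n t
    rw [h, Complex.norm_of_nonneg hr]
  have : ((∫ t, ‖φ n t‖ : ℝ) : ℂ) = 1 := by
    rw [← integral_complex_ofReal]
    simp only [hnorm, hφ.2.1]
  exact_mod_cast this

theorem eventually_tsupport_subset (hφ : IsDeltaSequence τ φ) {s : Set ℝ} (hs : s ∈ 𝓝 τ) :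
    ∀ᶠ n in atTop, tsupport (φ n) ⊆ s := by
  obtain ⟨r, hr, hrs⟩ := Metric.mem_nhds_iff.1 hs
  exact (hφ.2.2 r hr).mono fun n hn => hn.trans hrs

theorem tendsto_integral_mul (hφ : IsDeltaSequence τ φ) {g : ℝ → ℂ} (hg : ContinuousAt g τ)
    (hm : AEStronglyMeasurable g) :
    Tendsto (fun n => ∫ t, φ n t * g t) atTop (𝓝 (g τ)) := by
  rw [Metric.tendsto_nhds]
  intro ε hε
  have hnear : ∀ᶠ t in 𝓝 τ, ‖g t - g τ‖ < ε / 2 := by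
    simpa only [dist_eq_norm] using Metric.tendsto_nhds.1 hg (ε / 2) (half_pos hε)
  filter_upwards [hφ.eventually_tsupport_subset hnear] with n hn
  have hle (t : ℝ) : ‖φ n t * (g t - g τ)‖ ≤ ‖φ n t‖ * (ε / 2) := by
    rw [norm_mul]
    by_cases ht : φ n t = 0
    · simp [ht]
    · gcongr
      exact (hn (subset_tsupport _ ht)).le
  have hbound : Integrable fun t => ‖φ n t‖ * (ε / 2) := (φ n).integrable.norm.mul_const _
  have hdiff : Integrable fun t => φ n t * (g t - g τ) :=
    hbound.mono' ((φ n).continuous.aestronglyMeasurable.mul (hm.sub aestronglyMeasurable_const))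
      (ae_of_all _ hle)
  have hsplit : ∫ t, φ n t * g t = (∫ t, φ n t * (g t - g τ)) + g τ := by
    calc _ = ∫ t, (φ n t * (g t - g τ) + φ n t * g τ) := by simp only [← mul_add, sub_add_cancel]
      _ = _ := by
        rw [integral_add hdiff ((φ n).integrable.mul_const _), integral_mul_const, hφ.2.1, one_mul]
  rw [hsplit, dist_eq_norm, add_sub_cancel_right]
  calc _ ≤ ∫ t, ‖φ n t‖ * (ε / 2) := norm_integral_le_of_norm_le hbound (ae_of_all _ hle)
    _ = ε / 2 := by rw [integral_mul_const, hφ.integral_norm, one_mul]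
    _ < ε := half_lt_self hε

end IsDeltaSequence

section Response

variable (a b : ℂ) {s : ℂ} {k : ℕ}

theorem apply_eq_remOp {τ : ℝ} {U : 𝓢'(ℝ, ℂ)}
    (hU : IsInvFourier (fun ω => remSymbol a b s k τ (-ω)) U) (ψ : 𝓢(ℝ, ℂ)) :
    U ψ = remOp a b s k 0 ψ τ := by
  simp only [(hU ψ).2, integral_mul_invAngFourier, remOp, dampedSymbol_zero, neg_neg]

variable (hk : -1 < s.re + k)

include hk in
theorem exists_isInvFourier_remSymbol (τ : ℝ) :
    ∃ U : 𝓢'(ℝ, ℂ), IsInvFourier (fun ω => remSymbol a b s k τ (-ω)) U := by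
  refine (isTempered_of_norm_le_abs_rpow (C := (‖a‖ + ‖b‖) * |τ| ^ k) hk
    (by fun_prop : Measurable _).aestronglyMeasurable (ae_of_all _ fun ω => ?_)).exists_isInvFourier
  simpa only [abs_neg] using norm_remSymbol_le a b s k τ (-ω)

include hk in
theorem isImpulseResponse_of_eq_remOp {L : 𝓢(ℝ, ℂ) → 𝓢(ℝ, ℂ) → ℂ} {τ : ℝ} {U : 𝓢'(ℝ, ℂ)}
    (hL : ∀ φ ψ, L φ ψ = ∫ x, φ x * remOp a b s k 0 ψ x)
    (hU : ∀ ψ, U ψ = remOp a b s k 0 ψ τ) : IsImpulseResponse L τ U := by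
  intro φ hφ ψ
  have hcont : Continuous (remOp a b s k 0 ψ) :=
    (continuous_remOp a b hk ψ).comp (f := fun x : ℝ => (0, x)) (by fun_prop)
  simpa only [hL, hU] using
    hφ.tendsto_integral_mul hcont.continuousAt hcont.aestronglyMeasurable

variable (hs : ∀ n : ℕ, s + 1 ≠ -n)

include hk hs in
theorem agreesOn_remKernel {τ : ℝ} {U : 𝓢'(ℝ, ℂ)} {S : Set ℝ}
    (hU : ∀ ψ, U ψ = remOp a b s k 0 ψ τ) (hτ : τ ∉ S ∨ s.re < 0) (h0 : 0 ∉ S ∨ k = 0) :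
    AgreesOn U (remKernel a b s k 0 τ) S := by
  intro ψ hψ
  have hτψ := hτ.imp_left fun h => mt (@hψ τ) h
  have h0ψ := h0.imp_left fun h => mt (@hψ 0) h
  exact ⟨integrable_remKernel_mul a b hτψ h0ψ (by simp),
    (hU ψ).trans (remOp_zero_eq_integral_remKernel a b hk hs hτψ h0ψ)⟩

variable (hs0 : s.re < 0)

include hk hs hs0 in
theorem integral_remOp_mul_eq_integral_integral_remKernel {φ : 𝓢(ℝ, ℂ)} (h0 : 0 ∉ tsupport φ)
    (ψ : 𝓢(ℝ, ℂ)) :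
    ∫ x, remOp a b s k 0 φ x * ψ x = ∫ τ, φ τ * ∫ x, remKernel a b s k 0 x τ * ψ x := by
  have hswap : ∫ τ, ∫ x, remKernel a b s k 0 x τ * (φ τ * ψ x) =
      ∫ x, ∫ τ, remKernel a b s k 0 x τ * (φ τ * ψ x) :=
    integral_integral_swap (f := fun τ x => remKernel a b s k 0 x τ * (φ τ * ψ x))
      (integrable_prod_remKernel_mul a b k hs0 ψ h0)
  simp only [remOp_zero_eq_integral_remKernel a b hk hs (.inr hs0) (.inl h0),
    ← integral_mul_const, ← integral_const_mul, mul_assoc, ← hswap, mul_left_comm (φ _)]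

include hk hs hs0 in
theorem exists_isImpulseResponse_remOp {τ : ℝ} (hτ : τ ≠ 0) :
    ∃ U : 𝓢'(ℝ, ℂ), IsImpulseResponse (fun φ ψ => pairing (remOp a b s k 0 φ) ψ) τ U ∧
      AgreesOn U (fun x => remKernel a b s k 0 x τ) Set.univ := by
  obtain ⟨U, hU⟩ := (isTempered_remKernel a b k hs0 τ).exists_agreesOn_univ
  refine ⟨U, fun φ hφ ψ => ?_, hU⟩
  have hmeas : AEStronglyMeasurable fun t => ∫ x, remKernel a b s k 0 x t * ψ x :=
    (Measurable.stronglyMeasurable (f := fun q : ℝ × ℝ => remKernel a b s k 0 q.2 q.1 * ψ q.2)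
      (by fun_prop)).integral_prod_right'.aestronglyMeasurable
  rw [(hU ψ (Set.subset_univ _)).2]
  refine (hφ.tendsto_integral_mul (continuousAt_integral_remKernel_mul a b k hs0 ψ hτ)
    hmeas).congr' ?_
  filter_upwards [hφ.eventually_tsupport_subset (compl_singleton_mem_nhds hτ)] with n hn
  exact (integral_remOp_mul_eq_integral_integral_remKernel a b hk hs hs0 (fun h => hn h rfl)
    ψ).symm

include hk hs hs0 in
theorem agreesOn_integral_remKernel {φ : 𝓢(ℝ, ℂ)} {V : 𝓢'(ℝ, ℂ)}
    (hV : ∀ ψ, V ψ = ∫ τ, φ τ * remOp a b s k 0 ψ τ) :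
    AgreesOn V (fun x => ∫ τ, remKernel a b s k 0 τ x * φ τ) {0}ᶜ := by
  intro ψ hψ
  have h0 : 0 ∉ tsupport ψ := fun h => hψ h rfl
  refine ⟨?_, ?_⟩
  · refine (integrable_prod_remKernel_mul a b k hs0 φ h0).integral_prod_left.congr
      (ae_of_all _ fun x => ?_)
    simp only [← integral_mul_const, mul_comm (ψ x), mul_assoc]
  · simpa only [hV, mul_comm] using
      integral_remOp_mul_eq_integral_integral_remKernel a b hk hs hs0 h0 φ

include hk hs in
theorem integral_mul_remOp_eq_integral_integral_remKernel {ε : ℝ} (hε : 0 < ε)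
    (φ ψ : 𝓢(ℝ, ℂ)) :
    ∫ τ, φ τ * remOp a b s k ε ψ τ = ∫ x, (∫ τ, remKernel a b s k ε τ x * φ τ) * ψ x := by
  have hint : Integrable (fun q : ℝ × ℝ => φ q.1 * (remKernel a b s k ε q.1 q.2 * ψ q.2))
      (volume.prod volume) := by
    obtain ⟨C, hC⟩ : ∃ C, ∀ x τ, ‖remKernel a b s k ε x τ‖ ≤ C * |x| ^ k :=
      ⟨_, fun x τ => norm_remKernel_le a b hk hε x τ hs⟩
    refine (((integrable_abs_pow_mul_norm k φ).mul_prod ψ.integrable.norm).const_mul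
      C).mono' ?_ (ae_of_all _ fun q => ?_)
    · exact (by fun_prop : Measurable _).aestronglyMeasurable
    · rw [norm_mul, norm_mul]
      calc _ ≤ ‖φ q.1‖ * (C * |q.1| ^ k * ‖ψ q.2‖) := by gcongr; exact hC _ _
        _ = _ := by ring
  simp only [remOp_eq_integral_remKernel a b hk ψ hs hε, ← integral_const_mul (φ _)]
  rw [integral_integral_swap hint]
  simp only [← integral_mul_const, mul_left_comm (φ _), mul_comm (φ _), mul_assoc]

include hk hs in
theorem tendsto_integral_integral_remKernel_mul (φ ψ : 𝓢(ℝ, ℂ)) :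
    Tendsto (fun ε => ∫ x, (∫ τ, remKernel a b s k ε τ x * φ τ) * ψ x) (𝓝[>] 0)
      (𝓝 (∫ τ, φ τ * remOp a b s k 0 ψ τ)) := by
  obtain ⟨C, hC⟩ := exists_norm_remOp_le a b hk ψ
  have hcont (ε : ℝ) : Continuous (remOp a b s k ε ψ) :=
    (continuous_remOp a b hk ψ).comp (f := fun x : ℝ => (ε, x)) (by fun_prop)
  have hlim : Tendsto (fun ε => ∫ τ, φ τ * remOp a b s k ε ψ τ) (𝓝[>] 0)
      (𝓝 (∫ τ, φ τ * remOp a b s k 0 ψ τ)) := by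
    refine tendsto_integral_filter_of_dominated_convergence (fun τ => C * (|τ| ^ k * ‖φ τ‖))
      (.of_forall fun ε => (φ.continuous.mul (hcont ε)).aestronglyMeasurable)
      (.of_forall fun ε => ae_of_all _ fun τ => ?_) ((integrable_abs_pow_mul_norm k φ).const_mul C)
      (ae_of_all _ fun τ => (tendsto_remOp a b hk ψ τ).const_mul _)
    rw [norm_mul]
    calc _ ≤ ‖φ τ‖ * (C * |τ| ^ k) := by gcongr; exact hC ε τ
      _ = _ := by ring
  refine hlim.congr' ?_
  filter_upwards [self_mem_nhdsWithin] with ε hε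
  exact integral_mul_remOp_eq_integral_integral_remKernel a b hk hs hε φ ψ

end Response

theorem AgreesOn.congr {U : 𝓢'(ℝ, ℂ)} {f g : ℝ → ℂ} {S : Set ℝ} (h : AgreesOn U f S)
    (hfg : Set.EqOn f g S) : AgreesOn U g S := by
  intro ψ hψ
  have hmul : (fun x => f x * ψ x) = fun x => g x * ψ x := by
    funext x
    by_cases hx : ψ x = 0
    · simp [hx]
    · rw [hfg (hψ (subset_tsupport _ hx))]
  rw [← hmul]
  exact h ψ hψ

section Derivative

variable (a b : ℂ) {γ : ℂ}

theorem kernelD_eq_remKernel (x τ : ℝ) : kernelD a b γ x τ = remKernel a b γ 0 0 x τ := by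
  rw [kernelD_eq_kernelDReg_zero, kernelDReg_eq_remKernel]

theorem kernelDReg_swap (ε x τ : ℝ) : kernelDReg a b γ ε x τ = kernelDReg b a γ ε τ x := by
  simp only [kernelDReg, add_comm (a / _)]

theorem kernelD_swap (x τ : ℝ) : kernelD a b γ x τ = kernelD b a γ τ x := by
  simp only [kernelD, add_comm (a / _)]

variable (hγ : -1 < γ.re)

include hγ in
theorem add_one_ne_neg_natCast (n : ℕ) : γ + 1 ≠ -n := fun h => by
  have hre := congrArg Complex.re h
  simp only [Complex.add_re, Complex.one_re, Complex.neg_re, Complex.natCast_re] at hre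
  linarith [n.cast_nonneg (α := ℝ)]

include hγ in
theorem exists_isImpulseResponse_fracD (τ : ℝ) :
    ∃ U : 𝓢'(ℝ, ℂ),
      IsImpulseResponse (fun φ ψ => pairing (fracD a b γ φ) ψ) τ U ∧
      IsInvFourier (fun ω => fourierDirac τ ω * homMult a b γ ω) U ∧
      AgreesOn U (fun x => kernelD a b γ x τ) {τ}ᶜ ∧
      ∀ ψ : 𝓢(ℝ, ℂ),
        Tendsto (fun ε : ℝ => ∫ x : ℝ, kernelDReg a b γ ε x τ * ψ x) (𝓝[>] 0) (𝓝 (U ψ)) := by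
  have hk : -1 < γ.re + (0 : ℕ) := by simpa
  have hpoles := add_one_ne_neg_natCast hγ
  have hsymbol (ω : ℝ) :
      remSymbol b a γ 0 τ (-ω) = fourierDirac τ ω * homMult a b γ ω := by
    simp [remSymbol, expRem_zero, homMult_neg, fourierDirac, mul_comm, mul_left_comm]
  obtain ⟨U, hU⟩ := exists_isInvFourier_remSymbol b a hk τ
  have hUψ := apply_eq_remOp b a hU
  refine ⟨U, isImpulseResponse_of_eq_remOp b a hk (fun φ ψ => ?_) hUψ, ?_, ?_, fun ψ => ?_⟩
  · simpa only [pairing, fracD_eq_remOp, mul_comm] using integral_mul_remOp_comm a b hγ φ ψ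
  · simpa only [hsymbol] using hU
  · simp only [kernelD_swap a b, kernelD_eq_remKernel]
    exact agreesOn_remKernel b a hk hpoles hUψ (.inl fun h => h rfl) (.inr rfl)
  · simp only [kernelDReg_swap a b, kernelDReg_eq_remKernel, hUψ]
    exact tendsto_integral_remKernel_mul_remOp b a hk ψ hpoles τ

include hγ in
theorem fracD_eq_integral_kernelD (φ : 𝓢(ℝ, ℂ)) (x : ℝ) (hx : x ∉ tsupport φ) :
    Integrable (fun τ => kernelD a b γ x τ * φ τ) ∧
      fracD a b γ φ x = ∫ τ : ℝ, kernelD a b γ x τ * φ τ := by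
  simp only [kernelD_eq_remKernel, fracD_eq_remOp]
  exact ⟨integrable_remKernel_mul a b (.inl hx) (.inr rfl) (by simp),
    remOp_zero_eq_integral_remKernel a b (by simpa) (add_one_ne_neg_natCast hγ) (.inl hx)
      (.inr rfl)⟩

include hγ in
theorem tendsto_integral_kernelDReg (φ : 𝓢(ℝ, ℂ)) (x : ℝ) :
    Tendsto (fun ε : ℝ => ∫ τ : ℝ, kernelDReg a b γ ε x τ * φ τ) (𝓝[>] 0)
      (𝓝 (fracD a b γ φ x)) := by
  simp only [kernelDReg_eq_remKernel, fracD_eq_remOp]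
  exact tendsto_integral_remKernel_mul_remOp a b (by simpa) φ (add_one_ne_neg_natCast hγ) x

end Derivative

section Integrator

variable (a b : ℂ) {γ : ℂ} {k : ℕ}

theorem kernelI_eq_remKernel {τ : ℝ} (hτ : τ ≠ 0) (x : ℝ) :
    kernelI a b γ k x τ = remKernel a⁻¹ b⁻¹ (-γ) k 0 x τ := by
  rw [kernelI_eq_kernelIReg_zero, kernelIReg_eq_remKernel a b k γ (.inr hτ)]

theorem kernelI_mul_eq_remKernel_mul {φ : 𝓢(ℝ, ℂ)} (h0 : 0 ∉ tsupport φ) (x τ : ℝ) :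
    kernelI a b γ k x τ * φ τ = remKernel a⁻¹ b⁻¹ (-γ) k 0 x τ * φ τ := by
  rcases eq_or_ne τ 0 with rfl | hτ
  · simp [image_eq_zero_of_notMem_tsupport h0]
  · rw [kernelI_eq_remKernel a b hτ]

theorem eventually_kernelIReg_eq_remKernel :
    ∀ᶠ ε in 𝓝[>] 0, ∀ x τ, kernelIReg a b γ k ε x τ = remKernel a⁻¹ b⁻¹ (-γ) k ε x τ := by
  filter_upwards [self_mem_nhdsWithin] with ε hε x τ
  exact kernelIReg_eq_remKernel a b k γ (.inl (ne_of_gt hε)) x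

variable (hγ : ∀ n : ℕ, γ ≠ n + 1) (hk : γ.re < k + 1)

include hγ in
theorem neg_add_one_ne_neg_natCast (n : ℕ) : -γ + 1 ≠ -n := fun h =>
  hγ n (by linear_combination -h)

include hk in
theorem neg_one_lt_neg_re_add_natCast : -1 < (-γ).re + k := by
  rw [Complex.neg_re]
  linarith

include hγ hk in
theorem tendsto_integral_kernelIReg (φ : 𝓢(ℝ, ℂ)) (x : ℝ) :
    Tendsto (fun ε : ℝ => ∫ τ : ℝ, kernelIReg a b γ k ε x τ * φ τ) (𝓝[>] 0)
      (𝓝 (fracI a b γ k φ x)) := by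
  rw [fracI_eq_remOp]
  refine (tendsto_integral_remKernel_mul_remOp _ _ (neg_one_lt_neg_re_add_natCast hk) φ
    (neg_add_one_ne_neg_natCast hγ) x).congr' ?_
  filter_upwards [eventually_kernelIReg_eq_remKernel a b (γ := γ) (k := k)] with ε hε
  simp only [hε]

variable (hγ0 : 0 < γ.re)

include hγ hk hγ0 in
theorem exists_isImpulseResponse_fracI {τ : ℝ} (hτ : τ ≠ 0) :
    ∃ U : 𝓢'(ℝ, ℂ),
      IsImpulseResponse (fun φ ψ => pairing (fracI a b γ k φ) ψ) τ U ∧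
      AgreesOn U (fun x => kernelI a b γ k x τ) Set.univ := by
  simp only [kernelI_eq_remKernel a b hτ, funext (fracI_eq_remOp a b k γ _)]
  exact exists_isImpulseResponse_remOp _ _ (neg_one_lt_neg_re_add_natCast hk)
    (neg_add_one_ne_neg_natCast hγ) (by simpa) hτ

include hγ hk hγ0 in
theorem fracI_eq_integral_kernelI (φ : 𝓢(ℝ, ℂ)) (h0 : 0 ∉ tsupport φ) (x : ℝ) :
    Integrable (fun τ => kernelI a b γ k x τ * φ τ) ∧
      fracI a b γ k φ x = ∫ τ : ℝ, kernelI a b γ k x τ * φ τ := by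
  have hx : x ∉ tsupport φ ∨ (-γ).re < 0 := .inr (by simpa)
  simp only [kernelI_mul_eq_remKernel_mul a b h0, fracI_eq_remOp]
  exact ⟨integrable_remKernel_mul _ _ hx (.inl h0) (by simp),
    remOp_zero_eq_integral_remKernel _ _ (neg_one_lt_neg_re_add_natCast hk)
      (neg_add_one_ne_neg_natCast hγ) hx (.inl h0)⟩

include hγ hk hγ0 in
theorem exists_isImpulseResponse_fracIAdj (τ : ℝ) :
    ∃ U : 𝓢'(ℝ, ℂ),
      IsImpulseResponse (fracIAdj a b γ k) τ U ∧
      IsInvFourier (adjSymbol a b γ k (fourierDirac τ)) U ∧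
      AgreesOn U (fun x => kernelIAdj a b γ k x τ) {0}ᶜ ∧
      ∀ ψ : 𝓢(ℝ, ℂ),
        Tendsto (fun ε : ℝ => ∫ x : ℝ, kernelIAdjReg a b γ k ε x τ * ψ x) (𝓝[>] 0)
          (𝓝 (U ψ)) := by
  have hk' := neg_one_lt_neg_re_add_natCast hk
  obtain ⟨U, hU⟩ := exists_isInvFourier_remSymbol a⁻¹ b⁻¹ hk' τ
  have hUψ := apply_eq_remOp _ _ hU
  refine ⟨U, isImpulseResponse_of_eq_remOp _ _ hk' (fracIAdj_eq_integral_mul_remOp a b hk') hUψ,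
    ?_, ?_, fun ψ => ?_⟩
  · rwa [funext (adjSymbol_fourierDirac a b γ k τ)]
  · exact (agreesOn_remKernel (S := {0}ᶜ) _ _ hk' (neg_add_one_ne_neg_natCast hγ) hUψ
      (.inr (by simpa)) (.inl fun h => h rfl)).congr fun x hx =>
        (kernelI_eq_remKernel a b hx τ).symm
  · rw [hUψ, ← fracI_eq_remOp]
    exact tendsto_integral_kernelIReg a b hγ hk ψ τ

include hγ hk hγ0 in
theorem exists_distribution_fracIAdj (φ : 𝓢(ℝ, ℂ)) :
    ∃ V : 𝓢'(ℝ, ℂ),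
      (∀ ψ : 𝓢(ℝ, ℂ), V ψ = fracIAdj a b γ k φ ψ) ∧
      (∀ x : ℝ, x ≠ 0 → Integrable (fun τ => kernelIAdj a b γ k x τ * φ τ)) ∧
      AgreesOn V (fun x => ∫ τ : ℝ, kernelIAdj a b γ k x τ * φ τ) {0}ᶜ ∧
      ∀ ψ : 𝓢(ℝ, ℂ),
        Tendsto (fun ε : ℝ =>
            ∫ x : ℝ, (∫ τ : ℝ, kernelIAdjReg a b γ k ε x τ * φ τ) * ψ x) (𝓝[>] 0)
          (𝓝 (V ψ)) := by
  have hk' := neg_one_lt_neg_re_add_natCast hk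
  have hpoles := neg_add_one_ne_neg_natCast hγ
  have hre : (-γ).re < 0 := by simpa
  simp only [kernelIAdj_eq_kernelI, kernelIAdjReg_eq_kernelIReg]
  obtain ⟨V, hV⟩ := exists_isInvFourier_adjSymbol_angFourier a b hk' φ
  have hVψ (ψ : 𝓢(ℝ, ℂ)) : V ψ = fracIAdj a b γ k φ ψ := (hV ψ).2
  simp only [fracIAdj_eq_integral_mul_remOp a b hk'] at hVψ ⊢
  refine ⟨V, hVψ, fun x hx => ?_, ?_, fun ψ => ?_⟩
  · simpa only [kernelI_eq_remKernel a b hx] using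
      (isTempered_remKernel _ _ k hre x).integrable_mul φ
  · exact (agreesOn_integral_remKernel _ _ hk' hpoles hre hVψ).congr fun x hx => by
      simp only [kernelI_eq_remKernel a b hx]
  · rw [hVψ]
    refine (tendsto_integral_integral_remKernel_mul _ _ hk' hpoles φ ψ).congr' ?_
    filter_upwards [eventually_kernelIReg_eq_remKernel a b (γ := γ) (k := k)] with ε hε
    simp only [hε]

end Integrator

end

theorem mainTheorem4_general (a b γ : ℂ) :
    (-1 < γ.re →
      (∀ τ : ℝ, ∃ U : 𝓢'(ℝ, ℂ),
        IsImpulseResponse (fun φ ψ => pairing (fracD a b γ φ) ψ) τ U ∧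
        IsInvFourier (fun ω => fourierDirac τ ω * homMult a b γ ω) U ∧
        AgreesOn U (fun x => kernelD a b γ x τ) {τ}ᶜ ∧
        ∀ ψ : 𝓢(ℝ, ℂ),
          Tendsto (fun ε : ℝ => ∫ x : ℝ, kernelDReg a b γ ε x τ * ψ x) (𝓝[>] 0) (𝓝 (U ψ))) ∧
      (∀ (φ : 𝓢(ℝ, ℂ)) (x : ℝ), x ∉ tsupport φ →
        Integrable (fun τ => kernelD a b γ x τ * φ τ) ∧
        fracD a b γ φ x = ∫ τ : ℝ, kernelD a b γ x τ * φ τ) ∧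
      (∀ (φ : 𝓢(ℝ, ℂ)) (x : ℝ),
        Tendsto (fun ε : ℝ => ∫ τ : ℝ, kernelDReg a b γ ε x τ * φ τ) (𝓝[>] 0)
          (𝓝 (fracD a b γ φ x)))) ∧
    (a ≠ 0 → b ≠ 0 → 0 < γ.re → (∀ n : ℕ, γ ≠ n + 1) → ∀ k : ℕ, γ.re < k + 1 →
      ((∀ τ : ℝ, τ ≠ 0 → ∃ U : 𝓢'(ℝ, ℂ),
          IsImpulseResponse (fun φ ψ => pairing (fracI a b γ k φ) ψ) τ U ∧
          AgreesOn U (fun x => kernelI a b γ k x τ) Set.univ) ∧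
        (∀ φ : 𝓢(ℝ, ℂ), (0 : ℝ) ∉ tsupport φ → ∀ x : ℝ,
          Integrable (fun τ => kernelI a b γ k x τ * φ τ) ∧
          fracI a b γ k φ x = ∫ τ : ℝ, kernelI a b γ k x τ * φ τ) ∧
        (∀ (φ : 𝓢(ℝ, ℂ)) (x : ℝ),
          Tendsto (fun ε : ℝ => ∫ τ : ℝ, kernelIReg a b γ k ε x τ * φ τ) (𝓝[>] 0)
            (𝓝 (fracI a b γ k φ x)))) ∧
      ((∀ τ : ℝ, ∃ U : 𝓢'(ℝ, ℂ),
          IsImpulseResponse (fracIAdj a b γ k) τ U ∧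
          IsInvFourier (adjSymbol a b γ k (fourierDirac τ)) U ∧
          AgreesOn U (fun x => kernelIAdj a b γ k x τ) {0}ᶜ ∧
          ∀ ψ : 𝓢(ℝ, ℂ),
            Tendsto (fun ε : ℝ => ∫ x : ℝ, kernelIAdjReg a b γ k ε x τ * ψ x) (𝓝[>] 0)
              (𝓝 (U ψ))) ∧
        (∀ φ : 𝓢(ℝ, ℂ), ∃ V : 𝓢'(ℝ, ℂ),
          (∀ ψ : 𝓢(ℝ, ℂ), V ψ = fracIAdj a b γ k φ ψ) ∧
          (∀ x : ℝ, x ≠ 0 → Integrable (fun τ => kernelIAdj a b γ k x τ * φ τ)) ∧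
          AgreesOn V (fun x => ∫ τ : ℝ, kernelIAdj a b γ k x τ * φ τ) {0}ᶜ ∧
          ∀ ψ : 𝓢(ℝ, ℂ),
            Tendsto (fun ε : ℝ =>
                ∫ x : ℝ, (∫ τ : ℝ, kernelIAdjReg a b γ k ε x τ * φ τ) * ψ x) (𝓝[>] 0)
              (𝓝 (V ψ))))) := by
  refine ⟨fun hγ => ⟨exists_isImpulseResponse_fracD a b hγ, fracD_eq_integral_kernelD a b hγ,
    tendsto_integral_kernelDReg a b hγ⟩, fun _ _ hγ0 hγ k hk => ⟨⟨?_, ?_, ?_⟩, ?_, ?_⟩⟩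
  · exact fun τ hτ => exists_isImpulseResponse_fracI a b hγ hk hγ0 hτ
  · exact fracI_eq_integral_kernelI a b hγ hk hγ0
  · exact tendsto_integral_kernelIReg a b hγ hk
  · exact exists_isImpulseResponse_fracIAdj a b hγ hk hγ0
  · exact exists_distribution_fracIAdj a b hγ hk hγ0

end ComplexFrac

theorem mainTheorem4 (a b γ : ℂ) (ha : a ≠ 0) (hb : b ≠ 0) (hγ : ∀ n : ℤ, γ ≠ (n : ℂ)) :
    -- the derivative
    (-1 < γ.re →
      -- its response to a shifted Dirac impulse
      (∀ τ : ℝ, ∃ U : 𝓢'(ℝ, ℂ),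
        IsImpulseResponse (fun φ ψ => pairing (fracD a b γ φ) ψ) τ U ∧
        IsInvFourier (fun ω => fourierDirac τ ω * homMult a b γ ω) U ∧
        AgreesOn U (fun x => kernelD a b γ x τ) {τ}ᶜ ∧
        ∀ ψ : 𝓢(ℝ, ℂ),
          Tendsto (fun ε : ℝ => ∫ x : ℝ, kernelDReg a b γ ε x τ * ψ x) (𝓝[>] 0) (𝓝 (U ψ))) ∧
      -- its Schwartz kernel
      (∀ (φ : 𝓢(ℝ, ℂ)) (x : ℝ), x ∉ tsupport φ →
        Integrable (fun τ => kernelD a b γ x τ * φ τ) ∧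
        fracD a b γ φ x = ∫ τ : ℝ, kernelD a b γ x τ * φ τ) ∧
      (∀ (φ : 𝓢(ℝ, ℂ)) (x : ℝ),
        Tendsto (fun ε : ℝ => ∫ τ : ℝ, kernelDReg a b γ ε x τ * φ τ) (𝓝[>] 0)
          (𝓝 (fracD a b γ φ x)))) ∧
    -- the integrator and its adjoint
    (0 < γ.re → ∀ k : ℕ, 1 ≤ k → ⌊γ.re⌋ ≤ (k : ℤ) →
      -- the response of the integrator to a shifted Dirac impulse
      ((∀ τ : ℝ, τ ≠ 0 → ∃ U : 𝓢'(ℝ, ℂ),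
          IsImpulseResponse (fun φ ψ => pairing (fracI a b γ k φ) ψ) τ U ∧
          AgreesOn U (fun x => kernelI a b γ k x τ) Set.univ) ∧
        -- its Schwartz kernel
        (∀ φ : 𝓢(ℝ, ℂ), (0 : ℝ) ∉ tsupport φ → ∀ x : ℝ,
          Integrable (fun τ => kernelI a b γ k x τ * φ τ) ∧
          fracI a b γ k φ x = ∫ τ : ℝ, kernelI a b γ k x τ * φ τ) ∧
        (∀ (φ : 𝓢(ℝ, ℂ)) (x : ℝ),
          Tendsto (fun ε : ℝ => ∫ τ : ℝ, kernelIReg a b γ k ε x τ * φ τ) (𝓝[>] 0)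
            (𝓝 (fracI a b γ k φ x)))) ∧
      -- the response of the adjoint integrator to a shifted Dirac impulse
      ((∀ τ : ℝ, ∃ U : 𝓢'(ℝ, ℂ),
          IsImpulseResponse (fracIAdj a b γ k) τ U ∧
          IsInvFourier (adjSymbol a b γ k (fourierDirac τ)) U ∧
          AgreesOn U (fun x => kernelIAdj a b γ k x τ) {0}ᶜ ∧
          ∀ ψ : 𝓢(ℝ, ℂ),
            Tendsto (fun ε : ℝ => ∫ x : ℝ, kernelIAdjReg a b γ k ε x τ * ψ x) (𝓝[>] 0)
              (𝓝 (U ψ))) ∧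
        -- its Schwartz kernel
        (∀ φ : 𝓢(ℝ, ℂ), ∃ V : 𝓢'(ℝ, ℂ),
          (∀ ψ : 𝓢(ℝ, ℂ), V ψ = fracIAdj a b γ k φ ψ) ∧
          (∀ x : ℝ, x ≠ 0 → Integrable (fun τ => kernelIAdj a b γ k x τ * φ τ)) ∧
          AgreesOn V (fun x => ∫ τ : ℝ, kernelIAdj a b γ k x τ * φ τ) {0}ᶜ ∧
          ∀ ψ : 𝓢(ℝ, ℂ),
            Tendsto (fun ε : ℝ =>
                ∫ x : ℝ, (∫ τ : ℝ, kernelIAdjReg a b γ k ε x τ * φ τ) * ψ x) (𝓝[>] 0)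
              (𝓝 (V ψ))))) := by
  refine (mainTheorem4_general a b γ).imp_right fun hI hγ0 k _ hk => ?_
  exact hI ha hb hγ0 (fun n => by exact_mod_cast hγ (n + 1)) k
    (by exact_mod_cast Int.floor_le_iff.1 hk)
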